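/- Let $D(\mathbb{R})$ be the space of càdlàg functions $\omega:[0,\infty)\to\mathbb{R}$ with the Skorokhod ($J_1$) topology and its Borel $\sigma$-algebra. Fix $L\in\mathbb{R}$ and $D>0$. With $\sup\emptyset=0$ and $\inf\emptyset=\infty$, put for $\omega\in D(\mathbb{R})$ $$g^-_{L,t}(\omega)=\sup\{0\le s\le t:\omega_s\ge L\},\qquad \tau^-_{L,D}(\omega)=\inf\{t\ge 0: 1_{\{\omega_t<L\}}(t-g^-_{L,t}(\omega))\ge D\},$$ $\sigma_0^+(\omega)=0$ and, for $k\ge1$, $\sigma_k^-(\omega)=\inf\{t>\sigma_{k-1}^+(\omega):\omega_t<L\}$, $\sigma_k^+(\omega)=\inf\{t>\sigma_k^-(\omega):\omega_t\ge L\}$. Let \begin{align*} V&=\{\omega:\lim_{k\to\infty}\sigma_k^{\pm}(\omega)=\infty\},\qquad W=\{\omega:\sigma_k^+(\omega)-\sigma_k^-(\omega)\ne D\text{ for all }k\ge1\},\\ U^+&=\{\omega:\inf\{t\ge u:\omega_t\ge L\}=\inf\{t\ge u:\omega_t>L\}\text{ for all }u\ge0\},\\ U^-&=\{\omega:\inf\{t\ge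 u:\omega_t\le L\}=\inf\{t\ge u:\omega_t<L\}\text{ for all }u\ge0\} \end{align*} (in $W$, $\infty-\infty$ is read as $0$). Let $I\subseteq\mathbb{R}$ be an interval, and let $X$ be a càdlàg process, almost surely living on $I$, with generator $$\mathcal{G}f(x)=\tfrac12\sigma^2(x)f''(x)+\mu(x)f'(x)+\int_{\mathbb{R}}\big(f(x+z)-f(x)-z1_{\{|z|\le1\}}f'(x)\big)\,\nu(x,dz),\qquad f\in C_c^2(I),$$ where $\nu$ is a kernel with $\int(z^2\wedge1)\,\nu(x,dz)<\infty$ and $\nu(x,\{z:x+z\notin I\})=0$ for $x\in I$. That is, $X$ is adapted to some filtration and, for every $f\in C^2_c(I)$, $\mathcal{G}f(X_s)$ is integrable over $\Omega\times[0,t]$ for each $t$ and $f(X_t)-\int_0^t\mathcal{G}f(X_s)\,ds$ is a martingale. Here $f \in C_c^2(I)$ is understood as a compactly supported $C^2$ function on $\mathbb{R}$ whose support meets $I$ in a compact set. For each $n$ let $Y^{(n)}$ be a continuous-time Markov chain with càdlàg paths on a finite state space $\mathbb{S}_n\subset\mathbb{R}$, and suppose that $Y^{(n)}\Rightarrow X$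 weakly on $D(\mathbb{R})$. Suppose that $$\mathbb{P}[X\in V]=\mathbb{P}[X\in W]=\mathbb{P}[X\in U^+]=\mathbb{P}[X\in U^-]=1.$$ Let $f:\mathbb{R}\to\mathbb{R}$ be bounded with set of discontinuity points $\mathcal{D}$, and let $t>0$ satisfy $\mathbb{P}[X_t\in\mathcal{D}]=0$ and $\mathbb{P}[\tau^-_{L,D}(X)=t]=0$. Then the following expectations are well defined (the integrands are integrable), and $$\mathbb{E}\big[1_{\{\tau^-_{L,D}(Y^{(n)})\le t\}}f(Y^{(n)}_t)\big]\longrightarrow\mathbb{E}\big[1_{\{\tau^-_{L,D}(X)\le t\}}f(X_t)\big]\qquad(n\to\infty).$$ -/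

import Mathlib

open MeasureTheory ProbabilityTheory Filter Topology
open scoped NNReal ENNReal

/-- Real-valued càdlàg functions on `[0, ∞)`: the set underlying the Skorokhod space `D(ℝ)`. -/
structure CadlagPath where
  /-- the underlying function -/
  toFun : ℝ≥0 → ℝ
  /-- right continuity -/
  rightCts : ∀ t, ContinuousWithinAt toFun (Set.Ici t) t
  /-- existence of finite left limits (void at `t = 0`) -/
  leftLim : ∀ t, ∃ l : ℝ, Tendsto toFun (𝓝[<] t) (𝓝 l)

namespace CadlagPath

instance : CoeFun CadlagPath (fun _ => ℝ≥0 → ℝ) := ⟨CadlagPath.toFun⟩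

/-- Pairs of paths that are `ε`-close on `[0, T]` after a change of time (an increasing bijection
of `[0, ∞)`) that moves the points of `[0, T]` by less than `ε`. -/
def entourage (T : ℝ≥0) (ε : ℝ) : Set (CadlagPath × CadlagPath) :=
  {p | ∃ l : ℝ≥0 ≃o ℝ≥0, ∀ s ≤ T, dist (l s) s < ε ∧ dist (p.1 s) (p.2 (l s)) < ε}

theorem entourage_mono {T T' : ℝ≥0} {ε ε' : ℝ} (hT : T' ≤ T) (hε : ε ≤ ε') :
    entourage T ε ⊆ entourage T' ε' := by
  rintro p ⟨l, hl⟩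
  exact ⟨l, fun s hs => ⟨(hl s (hs.trans hT)).1.trans_le hε, (hl s (hs.trans hT)).2.trans_le hε⟩⟩

theorem le_add_one_of_dist_lt {a b : ℝ≥0} {ε : ℝ} (h : dist a b < ε) (hε : ε ≤ 1) :
    a ≤ b + 1 := by
  rw [NNReal.dist_eq, abs_lt] at h
  rw [← NNReal.coe_le_coe, NNReal.coe_add, NNReal.coe_one]
  linarith [h.2]

/-- The sets `entourage T ε`, for `T ≥ 0` and `ε > 0`, form a filter basis. -/
def entourageBasis : FilterBasis (CadlagPath × CadlagPath) where
  sets := {S | ∃ (T : ℝ≥0) (ε : ℝ), 0 < ε ∧ S = entourage T ε}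
  nonempty := ⟨_, 0, 1, one_pos, rfl⟩
  inter_sets := by
    rintro _ _ ⟨T, ε, hε, rfl⟩ ⟨T', ε', hε', rfl⟩
    exact ⟨_, ⟨max T T', min ε ε', lt_min hε hε', rfl⟩, Set.subset_inter
      (entourage_mono (le_max_left _ _) (min_le_left _ _))
      (entourage_mono (le_max_right _ _) (min_le_right _ _))⟩

theorem entourage_symm {T : ℝ≥0} {ε : ℝ} {p : CadlagPath × CadlagPath}
    (hp : p ∈ entourage (T + 1) (min ε 1)) : p.swap ∈ entourage T ε := by
  obtain ⟨l, hl⟩ := hp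
  refine ⟨l.symm, fun s hs => ?_⟩
  have hle : l.symm s ≤ T + 1 := by
    by_contra hcon
    rw [not_le] at hcon
    have h1 : l (T + 1) < s := by simpa using l.strictMono hcon
    have h2 := (hl (T + 1) le_rfl).1
    rw [NNReal.dist_eq, abs_lt] at h2
    have h3 : ((l (T + 1) : ℝ≥0) : ℝ) < T := by exact_mod_cast h1.trans_le hs
    have h4 : min ε 1 ≤ 1 := min_le_right _ _
    have h5 := h2.1
    push_cast at h5
    linarith
  obtain ⟨h1, h2⟩ := hl _ hle
  rw [OrderIso.apply_symm_apply] at h1 h2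
  refine ⟨?_, ?_⟩
  · rw [dist_comm]
    exact h1.trans_le (min_le_left _ _)
  · rw [dist_comm]
    exact h2.trans_le (min_le_left _ _)

theorem entourage_comp {T : ℝ≥0} {ε : ℝ} {x y z : CadlagPath}
    (hxy : (x, y) ∈ entourage (T + 1) (min (ε / 2) 1))
    (hyz : (y, z) ∈ entourage (T + 1) (min (ε / 2) 1)) : (x, z) ∈ entourage T ε := by
  obtain ⟨l, hl⟩ := hxy
  obtain ⟨m, hm⟩ := hyz
  refine ⟨l.trans m, fun s hs => ?_⟩
  obtain ⟨h1, h2⟩ := hl s (hs.trans (le_add_of_nonneg_right zero_le_one))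
  have hls : l s ≤ T + 1 :=
    (le_add_one_of_dist_lt h1 (min_le_right _ _)).trans (by gcongr)
  obtain ⟨h3, h4⟩ := hm (l s) hls
  have h5 : min (ε / 2) 1 ≤ ε / 2 := min_le_left _ _
  refine ⟨?_, ?_⟩
  · change dist (m (l s)) s < ε
    linarith [dist_triangle (m (l s)) (l s) s]
  · change dist (x s) (z (m (l s))) < ε
    change dist (x s) (y (l s)) < _ at h2
    change dist (y (l s)) (z (m (l s))) < _ at h4
    linarith [dist_triangle (x s) (y (l s)) (z (m (l s)))]

/-- The uniform structure of the Skorokhod (`J₁`) topology on `D(ℝ)`. In the induced topology,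
`ωₙ → ω` iff for all `T` there are increasing bijections `λₙ` of `[0, ∞)` such that
`λₙ(s) - s → 0` and `ωₙ(λₙ(s)) - ω(s) → 0`, both uniformly over `s ∈ [0, T]`. -/
instance : UniformSpace CadlagPath :=
  UniformSpace.ofCore <| UniformSpace.Core.mkOfBasis entourageBasis
    (by
      rintro _ ⟨T, ε, hε, rfl⟩ x
      exact ⟨OrderIso.refl _, fun s _ => by simpa using hε⟩)
    (by
      rintro _ ⟨T, ε, hε, rfl⟩
      exact ⟨_, ⟨T + 1, min ε 1, lt_min hε one_pos, rfl⟩, fun p hp => entourage_symm hp⟩)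
    (by
      rintro _ ⟨T, ε, hε, rfl⟩
      refine ⟨_, ⟨T + 1, min (ε / 2) 1, lt_min (half_pos hε) one_pos, rfl⟩, ?_⟩
      rintro ⟨x, z⟩ ⟨y, hxy, hyz⟩
      exact entourage_comp hxy hyz)

instance : MeasurableSpace CadlagPath := borel CadlagPath

instance : BorelSpace CadlagPath := ⟨rfl⟩

/-- `g⁻_{L,t}(ω) = sup {s ≤ t : ω_s ≥ L}`, with `sup ∅ = 0`. -/
noncomputable def lastAbove (L : ℝ) (ω : CadlagPath) (t : ℝ≥0) : ℝ≥0 :=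
  sSup {s : ℝ≥0 | s ≤ t ∧ L ≤ ω s}

/-- `1_{ω_t < L} (t - g⁻_{L,t}(ω))`, the age at time `t` of the current excursion below `L`. -/
noncomputable def ageBelow (L : ℝ) (ω : CadlagPath) (t : ℝ≥0) : ℝ :=
  {s : ℝ≥0 | ω s < L}.indicator (fun s => (s : ℝ) - (lastAbove L ω s : ℝ)) t

/-- The infimum in `[0, ∞]` of a set of times, with `inf ∅ = ∞`. -/
noncomputable def infTime (A : Set ℝ≥0) : ℝ≥0∞ := sInf ((fun t : ℝ≥0 => (t : ℝ≥0∞)) '' A)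

/-- The Parisian stopping time `τ⁻_{L,D}(ω)`: the first time at which the age of an excursion
below `L` reaches `D`. -/
noncomputable def parisianTime (L D : ℝ) (ω : CadlagPath) : ℝ≥0∞ :=
  infTime {t | D ≤ ageBelow L ω t}

/-- `inf {t > s : ω_t < L}` -/
noncomputable def nextBelow (L : ℝ) (ω : CadlagPath) (s : ℝ≥0∞) : ℝ≥0∞ :=
  infTime {t | s < t ∧ ω t < L}

/-- `inf {t > s : ω_t ≥ L}` -/
noncomputable def nextAbove (L : ℝ) (ω : CadlagPath) (s : ℝ≥0∞) : ℝ≥0∞ :=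
  infTime {t | s < t ∧ L ≤ ω t}

/-- `σ⁺_k`: `σ⁺_0 = 0` and `σ⁺_k = inf {t > σ⁻_k : ω_t ≥ L}` for `k ≥ 1`, where
`σ⁻_k = inf {t > σ⁺_{k-1} : ω_t < L}`. -/
noncomputable def sigmaPlus (L : ℝ) (ω : CadlagPath) : ℕ → ℝ≥0∞
  | 0 => 0
  | k + 1 => nextAbove L ω (nextBelow L ω (sigmaPlus L ω k))

/-- `σ⁻_{k+1} = inf {t > σ⁺_k : ω_t < L}`, indexed by `k ≥ 0`. -/
noncomputable def sigmaMinusSucc (L : ℝ) (ω : CadlagPath) (k : ℕ) : ℝ≥0∞ :=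
  nextBelow L ω (sigmaPlus L ω k)

/-- `V`: the excursion times tend to infinity. -/
def setV (L : ℝ) : Set CadlagPath :=
  {ω | Tendsto (sigmaMinusSucc L ω) atTop (𝓝 ∞) ∧ Tendsto (sigmaPlus L ω) atTop (𝓝 ∞)}

/-- `W`: `σ⁺_k - σ⁻_k ≠ D` for all `k ≥ 1`. (The difference is taken in `[0, ∞]`; both times
are infinite if there is no `k`-th excursion below `L`, and then the difference is `0`.) -/
def setW (L D : ℝ) : Set CadlagPath :=
  {ω | ∀ k : ℕ, sigmaPlus L ω (k + 1) - sigmaMinusSucc L ω k ≠ ENNReal.ofReal D}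

/-- `U⁺`: after any time `u`, the levels `≥ L` and `> L` are first reached at the same time. -/
def setUPlus (L : ℝ) : Set CadlagPath :=
  {ω | ∀ u : ℝ≥0, infTime {t | u ≤ t ∧ L ≤ ω t} = infTime {t | u ≤ t ∧ L < ω t}}

/-- `U⁻`: after any time `u`, the levels `≤ L` and `< L` are first reached at the same time. -/
def setUMinus (L : ℝ) : Set CadlagPath :=
  {ω | ∀ u : ℝ≥0, infTime {t | u ≤ t ∧ ω t ≤ L} = infTime {t | u ≤ t ∧ ω t < L}}

end CadlagPath

/-- A transition rate matrix on a finite set: nonnegative off the diagonal, zero row sums. -/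
structure IsRateMatrix {S : Finset ℝ} (G : Matrix S S ℝ) : Prop where
  nonneg_offDiag : ∀ x y, x ≠ y → 0 ≤ G x y
  row_sum : ∀ x, ∑ y, G x y = 0

/-- `Y` is a continuous-time Markov chain with finite state space `S ⊆ ℝ`, transition rate matrix
`G`, hence transition probabilities `exp (t G)`, and càdlàg paths (arbitrary initial law). -/
structure IsCTMC {Ω : Type*} [MeasurableSpace Ω] (P : Measure Ω) (S : Finset ℝ)
    (G : Matrix S S ℝ) (Y : Ω → CadlagPath) : Prop where
  isRateMatrix : IsRateMatrix G
  measurable_eval : ∀ t, Measurable (fun ω => Y ω t)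
  mem_states : ∀ᵐ ω ∂P, ∀ t, Y ω t ∈ S
  finiteDim : ∀ (k : ℕ) (t : Fin (k + 1) → ℝ≥0), Monotone t → ∀ x : Fin (k + 1) → S,
    P.real {ω | ∀ i, Y ω (t i) = x i} = P.real {ω | Y ω (t 0) = x 0} *
      ∏ i : Fin k, NormedSpace.exp (((t i.succ : ℝ) - (t i.castSucc : ℝ)) • G)
        (x i.castSucc) (x i.succ)

/-- A jump kernel on the interval `I`: `∫ (z² ∧ 1) ν(x, dz) < ∞`, and jumps do not leave `I`. -/
structure IsJumpKernel (I : Set ℝ) (ν : Kernel ℝ ℝ) : Prop where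
  lintegral_lt_top : ∀ x ∈ I, ∫⁻ z, ENNReal.ofReal (min (z ^ 2) 1) ∂(ν x) < ∞
  mem_of_jump : ∀ x ∈ I, ∀ᵐ z ∂(ν x), x + z ∈ I

/-- The integro-differential operator
`½ σ²(x) f''(x) + μ(x) f'(x) + ∫ (f(x+z) - f(x) - z 1_{|z| ≤ 1} f'(x)) ν(x, dz)`. -/
noncomputable def generator (μ σ : ℝ → ℝ) (ν : Kernel ℝ ℝ) (f : ℝ → ℝ) (x : ℝ) : ℝ :=
  1 / 2 * σ x ^ 2 * iteratedDeriv 2 f x + μ x * deriv f x +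
    ∫ z, (f (x + z) - f x - {z : ℝ | |z| ≤ 1}.indicator (fun z => z) z * deriv f x) ∂(ν x)

/-- `f` is (an extension to `ℝ` of) an element of `C_c²(I)`: twice continuously differentiable,
and the support of its restriction to `I` is compact. -/
structure IsTestFunction (I : Set ℝ) (f : ℝ → ℝ) : Prop where
  contDiff : ContDiff ℝ 2 f
  hasCompactSupport : HasCompactSupport f
  isCompact_inter : IsCompact (I ∩ tsupport f)

/-- `X` is a càdlàg process that lives on `I` and has generator `generator μ σ ν` on `C_c²(I)`,
in the sense of the martingale problem: it is adapted to `ℱ`, and for every `f ∈ C_c²(I)` the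
process `f(X_t) - ∫_0^t 𝒢f(X_s) ds` is well defined and an `ℱ`-martingale. -/
structure HasGenerator {Ω : Type*} {mΩ : MeasurableSpace Ω} (P : Measure Ω)
    (ℱ : Filtration ℝ≥0 mΩ) (I : Set ℝ) (μ σ : ℝ → ℝ) (ν : Kernel ℝ ℝ)
    (X : Ω → CadlagPath) : Prop where
  adapted : ∀ t, Measurable[ℱ t] (fun ω => X ω t)
  mem_interval : ∀ᵐ ω ∂P, ∀ t, X ω t ∈ I
  integrable_generator : ∀ f, IsTestFunction I f → ∀ t : ℝ≥0,
    Integrable (fun p : Ω × ℝ => generator μ σ ν f (X p.1 p.2.toNNReal))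
      (P.prod (volume.restrict (Set.Icc 0 (t : ℝ))))
  martingale : ∀ f, IsTestFunction I f →
    Martingale (fun (t : ℝ≥0) ω =>
      f (X ω t) - ∫ s in (0 : ℝ)..t, generator μ σ ν f (X ω s.toNNReal)) ℱ P

/-! The functional `F ω = 1_{τ ≤ t} f(ω_t)` is bounded, and it is `J₁`-continuous at almost every
path of `X`; the mapping theorem (`tendsto_integral_of_ae_continuousAt`) then gives the convergence.
`F` is not shown to be Borel: measurability along `Y n` comes from the finite state space, and along
`X` from the almost sure continuity.

Everything rests on reading `τ ≤ t` as: for some `s ≤ t` the path is below `L` on the window `(s -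
D, s]` (`parisianTime_le_iff`). Off the event `τ = t` the indicator is locally constant near `ω`. If
`τ < t`, a window slightly longer than `D` fits before `t`, and nearby paths inherit it as soon as
`ω` is bounded away from `L` there (`eventually_parisianTime_le`). The only obstruction is a left
limit equal to `L` inside an excursion (`NoLeftTouch`). If `τ > t` and nearby paths had windows
before `t`, a limit window would have `ω ≤ L` inside, hence `ω < L` by `U⁺`; it would be a full
excursion of length exactly `D`, which `V` and `W` exclude (`eventually_lt_parisianTime`).

The martingale problem supplies the rest through quasi-left-continuity. By Dynkin's formula `E
f(X_τ)` is continuous along convergent bounded optional times, so `f(X)` cannot leave `0` by a jump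
at their limit (`HasGenerator.ae_eq_zero_of_eventually`). Deterministic times `s n ↑ t` show that
`X` is almost surely continuous at `t`; hitting times of levels increasing to `L` give
`NoLeftTouch`. -/

namespace CadlagPath

/-! ### Neighbourhoods in the Skorokhod topology -/

theorem hasBasis_uniformity :
    (uniformity CadlagPath).HasBasis (fun p : ℝ≥0 × ℝ => 0 < p.2) fun p => entourage p.1 p.2 := by
  refine ⟨fun S => ?_⟩
  change S ∈ entourageBasis.filter ↔ _
  rw [FilterBasis.mem_filter_iff]
  constructor
  · rintro ⟨_, ⟨T, ε, hε, rfl⟩, h⟩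
    exact ⟨(T, ε), hε, h⟩
  · rintro ⟨⟨T, ε⟩, hε, h⟩
    exact ⟨_, ⟨T, ε, hε, rfl⟩, h⟩

theorem hasBasis_nhds (x : CadlagPath) :
    (𝓝 x).HasBasis (fun p : ℝ≥0 × ℝ => 0 < p.2) fun p => {y | (x, y) ∈ entourage p.1 p.2} :=
  nhds_basis_uniformity' hasBasis_uniformity

theorem eventually_nhds_iff {x : CadlagPath} {p : CadlagPath → Prop} :
    (∀ᶠ y in 𝓝 x, p y) ↔ ∃ (T : ℝ≥0) (ε : ℝ), 0 < ε ∧ ∀ y, (x, y) ∈ entourage T ε → p y := by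
  rw [(hasBasis_nhds x).eventually_iff]
  constructor
  · rintro ⟨⟨T, ε⟩, hε, h⟩
    exact ⟨T, ε, hε, fun y hy => h hy⟩
  · rintro ⟨T, ε, hε, h⟩
    exact ⟨(T, ε), hε, fun y hy => h y hy⟩

/-- Makes the path space pseudo-metrizable, as the Lipschitz regularization in the mapping theorem
requires. -/
instance : (uniformity CadlagPath).IsCountablyGenerated := by
  have h : (uniformity CadlagPath).HasBasis (fun _ : ℕ => True)
      fun n => entourage (n : ℝ≥0) (1 / ((n : ℝ) + 1)) := by
    refine hasBasis_uniformity.to_hasBasis ?_ fun n _ => ⟨(n, 1 / ((n : ℝ) + 1)), by positivity,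
      subset_rfl⟩
    rintro ⟨T, ε⟩ hε
    obtain ⟨m, hm⟩ := exists_nat_one_div_lt hε
    obtain ⟨k, hk⟩ := exists_nat_ge T
    refine ⟨max m k, trivial, entourage_mono (hk.trans (by exact_mod_cast le_max_right m k)) ?_⟩
    refine le_trans ?_ hm.le
    have : (m : ℝ) ≤ (max m k : ℕ) := by exact_mod_cast le_max_left m k
    gcongr
  exact h.isCountablyGenerated

end CadlagPath

/-! ### Mapping theorem for almost everywhere continuous functionals -/

section AEContinuous

variable {E : Type*} [TopologicalSpace E] [MeasurableSpace E] [BorelSpace E]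

/-- A function that is continuous at almost every point of the law of `X` composes with `X` to an
almost everywhere measurable function. -/
theorem aemeasurable_comp_of_ae_continuousAt {Ω : Type*} {m : MeasurableSpace Ω} {P : Measure Ω}
    {X : Ω → E} (hX : AEMeasurable X P) {F : E → ℝ} (hF : ∀ᵐ ω ∂P, ContinuousAt F (X ω)) :
    AEMeasurable (fun ω => F (X ω)) P := by
  -- The continuity points form a Gδ set, so `F` set to `0` off them is Borel, whatever `F` is
  -- elsewhere.
  have hC : MeasurableSet {x | ContinuousAt F x} := (IsGδ.setOfPred_continuousAt F).measurableSet
  have hG : Measurable ({x | ContinuousAt F x}.indicator F) := by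
    classical
    refine measurable_of_restrict_of_restrict_compl hC ?_ ?_
    · have : Continuous ({x | ContinuousAt F x}.domRestrict F) :=
        continuousOn_iff_continuous_domRestrict.1 fun x hx => ContinuousAt.continuousWithinAt hx
      convert this.measurable using 1
      exact funext fun x => Set.indicator_of_mem x.2 F
    · convert measurable_const (a := (0 : ℝ)) using 1
      exact funext fun x => Set.indicator_of_notMem x.2 F
  refine (hG.comp_aemeasurable hX).congr ?_
  filter_upwards [hF] with ω hω
  exact Set.indicator_of_mem (s := {x | ContinuousAt F x}) hω F

end AEContinuous

section Regularization

variable {E : Type*} [PseudoMetricSpace E]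

/-- The largest `k`-Lipschitz minorant of `F`. -/
noncomputable def lipschitzMinorant (F : E → ℝ) (k : ℕ) (x : E) : ℝ :=
  ⨅ y, (F y + k * dist x y)

variable {F : E → ℝ} {C : ℝ}

theorem bddBelow_lipschitzMinorant (hF : ∀ x, |F x| ≤ C) (k : ℕ) (x : E) :
    BddBelow (Set.range fun y => F y + k * dist x y) := by
  refine ⟨-C, ?_⟩
  rintro _ ⟨y, rfl⟩
  have h1 := (abs_le.1 (hF y)).1
  have h2 : 0 ≤ (k : ℝ) * dist x y := by positivity
  change -C ≤ F y + k * dist x y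
  linarith

theorem lipschitzMinorant_le (hF : ∀ x, |F x| ≤ C) (k : ℕ) (x : E) :
    lipschitzMinorant F k x ≤ F x := by
  have h := ciInf_le (bddBelow_lipschitzMinorant hF k x) x
  simpa [lipschitzMinorant] using h

theorem neg_le_lipschitzMinorant (hF : ∀ x, |F x| ≤ C) (k : ℕ) (x : E) :
    -C ≤ lipschitzMinorant F k x := by
  have : Nonempty E := ⟨x⟩
  refine le_ciInf fun y => ?_
  have h1 := (abs_le.1 (hF y)).1
  have h2 : 0 ≤ (k : ℝ) * dist x y := by positivity
  linarith

theorem abs_lipschitzMinorant_le (hF : ∀ x, |F x| ≤ C) (k : ℕ) (x : E) :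
    |lipschitzMinorant F k x| ≤ C :=
  abs_le.2 ⟨neg_le_lipschitzMinorant hF k x,
    (lipschitzMinorant_le hF k x).trans (abs_le.1 (hF x)).2⟩

theorem continuous_lipschitzMinorant (hF : ∀ x, |F x| ≤ C) (k : ℕ) :
    Continuous (lipschitzMinorant F k) := by
  refine (LipschitzWith.of_le_add_mul (k : ℝ≥0) fun x y => ?_).continuous
  have : Nonempty E := ⟨x⟩
  rw [← sub_le_iff_le_add]
  refine le_ciInf fun z => ?_
  have h1 : lipschitzMinorant F k x ≤ F z + k * dist x z :=
    ciInf_le (bddBelow_lipschitzMinorant hF k x) z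
  have h2 : (k : ℝ) * dist x z ≤ k * (dist x y + dist y z) := by
    gcongr
    exact dist_triangle x y z
  have h3 : (((k : ℝ≥0) : ℝ≥0) : ℝ) = k := by simp
  rw [h3]
  linarith

theorem tendsto_lipschitzMinorant (hF : ∀ x, |F x| ≤ C) {x : E} (hx : ContinuousAt F x) :
    Tendsto (fun k => lipschitzMinorant F k x) atTop (𝓝 (F x)) := by
  have : Nonempty E := ⟨x⟩
  refine tendsto_order.2 ⟨fun a ha => ?_, fun a ha => Eventually.of_forall fun k =>
    (lipschitzMinorant_le hF k x).trans_lt ha⟩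
  obtain ⟨b, hab, hb⟩ := exists_between ha
  obtain ⟨δ, hδ, hball⟩ := Metric.eventually_nhds_iff.1 (hx.eventually (lt_mem_nhds hb))
  -- For `k ≥ N`, points at distance at least `δ` contribute at least `-C + kδ ≥ b`; closer points
  -- have `F > b`.
  obtain ⟨N, hN⟩ := exists_nat_ge ((C + b) / δ)
  filter_upwards [eventually_ge_atTop N] with k hk
  refine hab.trans_le (le_ciInf fun y => ?_)
  rcases lt_or_ge (dist y x) δ with h | h
  · have h2 : 0 ≤ (k : ℝ) * dist x y := by positivity
    linarith [hball h]
  · have h1 := (abs_le.1 (hF y)).1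
    have h2 : C + b ≤ N * δ := (div_le_iff₀ hδ).1 hN
    have h3 : (N : ℝ) * δ ≤ k * dist x y := by
      rw [dist_comm]
      gcongr
    linarith

end Regularization

section Mapping

variable {E : Type*} [TopologicalSpace E] [MeasurableSpace E] [BorelSpace E]
  {Ω : Type*} {m : MeasurableSpace Ω} {P : Measure Ω} [IsProbabilityMeasure P]
  {Ω' : ℕ → Type*} {m' : ∀ n, MeasurableSpace (Ω' n)} {P' : ∀ n, Measure (Ω' n)}
  [∀ n, IsProbabilityMeasure (P' n)] {Y : ∀ n, Ω' n → E} {X : Ω → E}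

theorem MeasureTheory.TendstoInDistribution.tendsto_integral_of_continuous
    (h : TendstoInDistribution Y atTop X P' P) {g : E → ℝ} (hg : Continuous g) {C : ℝ}
    (hC : ∀ x, |g x| ≤ C) :
    Tendsto (fun n => ∫ ω, g (Y n ω) ∂(P' n)) atTop (𝓝 (∫ ω, g (X ω) ∂P)) := by
  have h1 := ProbabilityMeasure.tendsto_iff_forall_integral_tendsto.1 h.tendsto
    (BoundedContinuousFunction.ofNormedAddCommGroup g hg C hC)
  simp only [ProbabilityMeasure.coe_mk, BoundedContinuousFunction.coe_ofNormedAddCommGroup] at h1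
  rw [integral_map h.aemeasurable_limit hg.aestronglyMeasurable] at h1
  refine h1.congr fun n => ?_
  rw [integral_map (h.forall_aemeasurable n) hg.aestronglyMeasurable]

variable [TopologicalSpace.PseudoMetrizableSpace E]

/-- Lower half of the mapping theorem: a continuous minorant of `F` already has integral above `a`
under the limit law, and weak convergence applies to it. The upper half is this applied to `-F`. -/
theorem eventually_lt_integral_of_ae_continuousAt
    (h : TendstoInDistribution Y atTop X P' P) {F : E → ℝ} {C : ℝ} (hC : ∀ x, |F x| ≤ C)
    (hY : ∀ n, AEMeasurable (fun ω => F (Y n ω)) (P' n))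
    (hF : ∀ᵐ ω ∂P, ContinuousAt F (X ω)) {a : ℝ} (ha : a < ∫ ω, F (X ω) ∂P) :
    ∀ᶠ n in atTop, a < ∫ ω, F (Y n ω) ∂(P' n) := by
  let _ := TopologicalSpace.pseudoMetrizableSpacePseudoMetric E
  have hlim : Tendsto (fun k => ∫ ω, lipschitzMinorant F k (X ω) ∂P) atTop
      (𝓝 (∫ ω, F (X ω) ∂P)) := by
    refine tendsto_integral_of_dominated_convergence (fun _ => C) (fun k => ?_)
      (integrable_const _) (fun k => .of_forall fun ω => abs_lipschitzMinorant_le hC k _) ?_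
    · exact ((continuous_lipschitzMinorant hC k).measurable.comp_aemeasurable
        h.aemeasurable_limit).aestronglyMeasurable
    · filter_upwards [hF] with ω hω using tendsto_lipschitzMinorant hC hω
  obtain ⟨k, hk⟩ := (hlim.eventually (lt_mem_nhds ha)).exists
  filter_upwards [(h.tendsto_integral_of_continuous (continuous_lipschitzMinorant hC k)
    (abs_lipschitzMinorant_le hC k)).eventually (lt_mem_nhds hk)] with n hn
  refine hn.trans_le (integral_mono ?_ ?_ fun ω => lipschitzMinorant_le hC k _)
  · exact .of_bound ((continuous_lipschitzMinorant hC k).measurable.comp_aemeasurable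
      (h.forall_aemeasurable n)).aestronglyMeasurable C
      (.of_forall fun ω => abs_lipschitzMinorant_le hC k _)
  · exact .of_bound (hY n).aestronglyMeasurable C (.of_forall fun ω => hC _)

/-- Convergence in distribution implies convergence of the integrals of bounded functions that are
continuous at almost every point of the limit law. -/
theorem tendsto_integral_of_ae_continuousAt
    (h : TendstoInDistribution Y atTop X P' P) {F : E → ℝ} {C : ℝ} (hC : ∀ x, |F x| ≤ C)
    (hY : ∀ n, AEMeasurable (fun ω => F (Y n ω)) (P' n))
    (hF : ∀ᵐ ω ∂P, ContinuousAt F (X ω)) :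
    Tendsto (fun n => ∫ ω, F (Y n ω) ∂(P' n)) atTop (𝓝 (∫ ω, F (X ω) ∂P)) := by
  refine tendsto_order.2 ⟨fun a ha => eventually_lt_integral_of_ae_continuousAt h hC hY hF ha,
    fun a ha => ?_⟩
  have := eventually_lt_integral_of_ae_continuousAt (F := fun x => -F x) (a := -a) h
    (fun x => (abs_neg (F x)).trans_le (hC x)) (fun n => (hY n).neg)
    (hF.mono fun ω hω => hω.neg) (by rw [integral_neg]; exact neg_lt_neg ha)
  filter_upwards [this] with n hn
  rw [integral_neg] at hn
  exact neg_lt_neg_iff.1 hn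

end Mapping

/-! ### Continuity of the Parisian functional -/

namespace CadlagPath

variable {L : ℝ} {d : ℝ≥0} {ω : CadlagPath}

theorem infTime_lt_iff {A : Set ℝ≥0} {a : ℝ≥0∞} : infTime A < a ↔ ∃ t ∈ A, (t : ℝ≥0∞) < a := by
  simp [infTime, sInf_lt_iff]

theorem le_infTime_iff {A : Set ℝ≥0} {a : ℝ≥0∞} : a ≤ infTime A ↔ ∀ t ∈ A, a ≤ (t : ℝ≥0∞) := by
  simp [infTime, le_sInf_iff]

theorem infTime_le {A : Set ℝ≥0} {t : ℝ≥0} (h : t ∈ A) : infTime A ≤ t :=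
  le_infTime_iff.1 le_rfl t h

theorem nextBelow_le {s : ℝ≥0∞} {t : ℝ≥0} (hs : s < t) (ht : ω t < L) : nextBelow L ω s ≤ t :=
  infTime_le ⟨hs, ht⟩

theorem nextAbove_le {s : ℝ≥0∞} {t : ℝ≥0} (hs : s < t) (ht : L ≤ ω t) : nextAbove L ω s ≤ t :=
  infTime_le ⟨hs, ht⟩

/-- `s ≥ d` and `ω` is below `L` on `(s - d, s]`. -/
def BelowDuring (L : ℝ) (d : ℝ≥0) (ω : CadlagPath) (s : ℝ≥0) : Prop :=
  d ≤ s ∧ ∀ r, s < r + d → r ≤ s → ω r < L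

/-- Positivity of `d` excludes the value `0` of the indicator; the convention `sup ∅ = 0` produces
`d ≤ s`. -/
theorem le_ageBelow_iff (hd : 0 < d) {s : ℝ≥0} :
    (d : ℝ) ≤ ageBelow L ω s ↔ BelowDuring L d ω s := by
  have hd' : (0 : ℝ) < d := hd
  unfold ageBelow BelowDuring
  constructor
  · intro h
    by_cases hs : ω s < L
    · rw [Set.indicator_of_mem (s := {s : ℝ≥0 | ω s < L}) hs] at h
      have h0 : (0 : ℝ) ≤ lastAbove L ω s := NNReal.coe_nonneg _
      refine ⟨by rw [← NNReal.coe_le_coe]; linarith, fun r hr hrs => ?_⟩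
      by_contra hL
      have h1 : r ≤ lastAbove L ω s := le_csSup ⟨s, fun x hx => hx.1⟩ ⟨hrs, not_lt.1 hL⟩
      rw [← NNReal.coe_lt_coe, NNReal.coe_add] at hr
      rw [← NNReal.coe_le_coe] at h1
      linarith
    · rw [Set.indicator_of_notMem (s := {s : ℝ≥0 | ω s < L}) hs] at h
      linarith
  · rintro ⟨hds, h⟩
    have hs : ω s < L := h s (lt_add_of_pos_right s hd) le_rfl
    rw [Set.indicator_of_mem (s := {s : ℝ≥0 | ω s < L}) hs]
    have h1 : lastAbove L ω s ≤ s - d := by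
      refine csSup_le' fun r hr => ?_
      refine le_tsub_of_add_le_right (le_of_not_gt fun hlt => ?_)
      exact absurd (h r hlt hr.1) (not_lt.2 hr.2)
    rw [← NNReal.coe_le_coe, NNReal.coe_sub hds] at h1
    linarith

theorem parisianTime_le_iff (hd : 0 < d) {t : ℝ≥0} :
    parisianTime L d ω ≤ t ↔ ∃ s ≤ t, BelowDuring L d ω s := by
  unfold parisianTime
  simp only [le_ageBelow_iff hd]
  constructor
  · intro h
    by_contra! hcon
    have key : ∀ ε > 0, ∃ s, BelowDuring L d ω s ∧ t < s ∧ s < t + ε := by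
      intro ε hε
      have h1 : infTime {s | BelowDuring L d ω s} < ((t + ε : ℝ≥0) : ℝ≥0∞) :=
        h.trans_lt (by exact_mod_cast lt_add_of_pos_right t hε)
      obtain ⟨s, hs, hst⟩ := infTime_lt_iff.1 h1
      exact ⟨s, hs, not_le.1 fun hle => hcon s hle hs, by exact_mod_cast hst⟩
    -- The infimum is attained: windows ending at times decreasing to `t` eventually contain each
    -- point of `(t - d, t]`, since the window is open on the left.
    refine hcon t le_rfl ⟨?_, fun r hr hrt => ?_⟩
    · refine le_of_forall_pos_le_add fun ε hε => ?_
      obtain ⟨s, hs, -, h2⟩ := key ε hε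
      exact hs.1.trans h2.le
    · obtain ⟨ε, hε, he⟩ := lt_iff_exists_pos_add.1 hr
      obtain ⟨s, hs, h1, h2⟩ := key ε hε
      exact hs.2 r (he ▸ h2) (hrt.trans h1.le)
  · rintro ⟨s, hst, hs⟩
    exact (infTime_le (A := {s | BelowDuring L d ω s}) hs).trans (by exact_mod_cast hst)

theorem exists_forall_Ico_lt {s : ℝ≥0} (h : ω s < L) :
    ∃ b, s < b ∧ ∀ r, s ≤ r → r < b → ω r < L := by
  have h1 := (ω.rightCts s).eventually (gt_mem_nhds h)
  obtain ⟨b, hb, hsub⟩ := mem_nhdsGE_iff_exists_Ico_subset.1 h1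
  exact ⟨b, hb, fun r h1 h2 => hsub ⟨h1, h2⟩⟩

/-- `ω` does not approach `L` from the left at the end of a time interval on which it is
below `L`. -/
def NoLeftTouch (L : ℝ) (ω : CadlagPath) : Prop :=
  ∀ u r, u < r → (∀ q, u ≤ q → q ≤ r → ω q < L) → ∃ c < L, ∀ᶠ q in 𝓝[<] r, ω q < c

/-- Compactness: near each point the path stays below some level `< L`, on the right by right
continuity and on the left by `NoLeftTouch`. -/
theorem NoLeftTouch.exists_forall_Icc_lt (hN : NoLeftTouch L ω) {a b : ℝ≥0}
    (h : ∀ q, a ≤ q → q ≤ b → ω q < L) : ∃ c < L, ∀ q, a ≤ q → q ≤ b → ω q < c := by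
  suffices H : ∃ c < L, ∀ q ∈ Set.Icc a b, ω q < c by
    obtain ⟨c, hc, H⟩ := H
    exact ⟨c, hc, fun q h1 h2 => H q ⟨h1, h2⟩⟩
  refine (isCompact_Icc (a := a) (b := b)).induction_on
    (p := fun S => ∃ c < L, ∀ q ∈ S, ω q < c) ?_ ?_ ?_ ?_
  · exact ⟨L - 1, by linarith, fun q hq => hq.elim⟩
  · rintro S T hST ⟨c, hc, hT⟩
    exact ⟨c, hc, fun q hq => hT q (hST hq)⟩
  · rintro S T ⟨c, hc, hS⟩ ⟨c', hc', hT⟩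
    refine ⟨max c c', max_lt hc hc', fun q hq => hq.elim (fun h => ?_) fun h => ?_⟩
    · exact (hS q h).trans_le (le_max_left _ _)
    · exact (hT q h).trans_le (le_max_right _ _)
  · rintro x ⟨hax, hxb⟩
    obtain ⟨c, hxc, hc⟩ := exists_between (h x hax hxb)
    have h1 : ∀ᶠ q in 𝓝[≥] x, ω q < c := (ω.rightCts x).eventually (gt_mem_nhds hxc)
    rcases hax.eq_or_lt with rfl | hlt
    · exact ⟨{q | ω q < c}, nhdsWithin_mono a (fun q hq => hq.1) h1, c, hc, fun q hq => hq⟩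
    · obtain ⟨c', hc', h2⟩ := hN a x hlt fun q h3 h4 => h q h3 (h4.trans hxb)
      refine ⟨{q | ω q < max c c'}, mem_nhdsWithin_of_mem_nhds ?_, max c c', max_lt hc hc',
        fun q hq => hq⟩
      rw [← nhdsLT_sup_nhdsGE x]
      exact ⟨h2.mono fun q hq => hq.trans_le (le_max_right _ _),
        h1.mono fun q hq => hq.trans_le (le_max_left _ _)⟩

theorem eventually_parisianTime_le (hd : 0 < d) (hN : NoLeftTouch L ω) {t : ℝ≥0}
    (h : parisianTime L d ω < t) : ∀ᶠ ω' in 𝓝 ω, parisianTime L d ω' ≤ t := by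
  obtain ⟨s, hs, hst⟩ := infTime_lt_iff.1 h
  rw [Set.mem_ofPred_eq, le_ageBelow_iff hd] at hs
  obtain ⟨hds, hbelow⟩ := hs
  have hst' : s < t := by exact_mod_cast hst
  obtain ⟨b, hsb, hb⟩ := exists_forall_Ico_lt (hbelow s (lt_add_of_pos_right s hd) le_rfl)
  obtain ⟨e, rfl⟩ := exists_add_of_le hds
  -- On `[e + η, d + e + 3η]`, of length `d + 2η`, the path is below some `c < L`. A time change by
  -- less than `η` costs at most `η` at either end, which leaves the window `(e + 2η, d + e + 2η]`
  -- for `ω'`.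
  obtain ⟨η, hη, hηb, hηt⟩ : ∃ η : ℝ≥0, 0 < η ∧ d + e + 3 * η < b ∧ d + e + 3 * η ≤ t := by
    obtain ⟨κ, hκ, hκe⟩ := lt_iff_exists_pos_add.1 (lt_min hsb hst')
    refine ⟨κ / 4, by positivity, ?_, ?_⟩
    · have : d + e + 3 * (κ / 4) < d + e + κ := by
        rw [← NNReal.coe_lt_coe] at hκ ⊢
        push_cast at hκ ⊢
        linarith
      exact this.trans_le (hκe ▸ min_le_left _ _)
    · have : d + e + 3 * (κ / 4) ≤ d + e + κ := by
        rw [← NNReal.coe_lt_coe] at hκ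
        rw [← NNReal.coe_le_coe]
        push_cast at hκ ⊢
        linarith
      exact this.trans (hκe ▸ min_le_right _ _)
  have hη' : (0 : ℝ) < η := hη
  obtain ⟨c, hc, hlt⟩ := hN.exists_forall_Icc_lt (a := e + η) (b := d + e + 3 * η) fun q h1 h2 => by
    rcases le_total q (d + e) with h3 | h3
    · refine hbelow q ?_ h3
      rw [← NNReal.coe_le_coe] at h1
      rw [← NNReal.coe_lt_coe]
      push_cast at h1 ⊢
      linarith
    · exact hb q h3 (h2.trans_lt hηb)
  refine eventually_nhds_iff.2 ⟨t, min η (L - c), lt_min hη' (by linarith), ?_⟩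
  rintro ω' ⟨l, hl⟩
  rw [parisianTime_le_iff hd]
  have hm1 : min (η : ℝ) (L - c) ≤ η := min_le_left _ _
  have hm2 : min (η : ℝ) (L - c) ≤ L - c := min_le_right _ _
  have hab : e + η ≤ d + e + 3 * η := by
    rw [← NNReal.coe_le_coe]
    push_cast
    linarith [NNReal.coe_nonneg d]
  have ha := (hl (e + η) (hab.trans hηt)).1
  have hb' := (hl (d + e + 3 * η) hηt).1
  rw [NNReal.dist_eq, abs_lt] at ha hb'
  push_cast at ha hb'
  refine ⟨d + e + 2 * η, ?_, ?_, fun r h1 h2 => ?_⟩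
  · refine le_trans ?_ hηt
    gcongr
    norm_num
  · rw [add_assoc]
    exact le_self_add
  · rw [← NNReal.coe_lt_coe] at h1
    rw [← NNReal.coe_le_coe] at h2
    push_cast at h1 h2
    have h3 : e + η ≤ l.symm r := by
      rw [OrderIso.le_symm_apply, ← NNReal.coe_le_coe]
      linarith
    have h4 : l.symm r ≤ d + e + 3 * η := by
      rw [OrderIso.symm_apply_le, ← NNReal.coe_le_coe]
      linarith
    have h5 := (hl _ (h4.trans hηt)).2
    rw [OrderIso.apply_symm_apply, Real.dist_eq, abs_lt] at h5
    change _ < ω (l.symm r) - ω' r ∧ _ at h5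
    linarith [hlt _ h3 h4]

/-- If `a` starts and `b` ends an excursion below `L`, these times are consecutive among
the excursion times. -/
theorem exists_sigma_eq (hV : Tendsto (sigmaPlus L ω) atTop (𝓝 ∞)) {a b : ℝ≥0} (hab : a < b)
    (hlt : ∀ q, a < q → q < b → ω q < L) (hb : L ≤ ω b)
    (ha : ∀ u < a, ∃ q, u < q ∧ q ≤ a ∧ L ≤ ω q) :
    ∃ k, sigmaMinusSucc L ω k = a ∧ sigmaPlus L ω (k + 1) = b := by
  obtain ⟨k, hk, hk'⟩ : ∃ k, sigmaPlus L ω k ≤ a ∧ (a : ℝ≥0∞) < sigmaPlus L ω (k + 1) := by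
    by_contra! hcon
    have hall : ∀ k, sigmaPlus L ω k ≤ a := by
      intro k
      induction k with
      | zero => simp [sigmaPlus]
      | succ k ih => exact hcon k ih
    obtain ⟨k, hk⟩ := (hV.eventually (lt_mem_nhds (ENNReal.coe_lt_top (r := a)))).exists
    exact absurd (hall k) (not_le.2 hk)
  have h1 : sigmaMinusSucc L ω k ≤ a := by
    refine le_of_forall_gt fun x hx => ?_
    obtain ⟨y, hay, hy⟩ := ENNReal.lt_iff_exists_nnreal_btwn.1 hx
    have hay' : a < y := by exact_mod_cast hay
    obtain ⟨q, haq, hq⟩ := exists_between (lt_min hay' hab)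
    refine (nextBelow_le (hk.trans_lt (by exact_mod_cast haq))
      (hlt q haq (hq.trans_le (min_le_right _ _)))).trans_lt (lt_trans ?_ hy)
    exact_mod_cast hq.trans_le (min_le_left _ _)
  have h2 : sigmaMinusSucc L ω k = a := by
    refine h1.eq_of_not_lt fun hlt' => ?_
    obtain ⟨u, hu, hua⟩ := ENNReal.lt_iff_exists_nnreal_btwn.1 hlt'
    obtain ⟨q, huq, hqa, hq⟩ := ha u (by exact_mod_cast hua)
    have h3 : sigmaPlus L ω (k + 1) ≤ q := nextAbove_le (hu.trans (by exact_mod_cast huq)) hq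
    exact absurd (h3.trans (by exact_mod_cast hqa)) (not_le.2 hk')
  refine ⟨k, h2, ?_⟩
  change nextAbove L ω (sigmaMinusSucc L ω k) = b
  rw [h2]
  refine le_antisymm (nextAbove_le (by exact_mod_cast hab) hb) (le_infTime_iff.2 ?_)
  rintro q ⟨haq, hq⟩
  by_contra! hqb
  exact absurd (hlt q (by exact_mod_cast haq) (by exact_mod_cast hqb)) (not_lt.2 hq)

/-- If the path met `L` at `q`, then by `U⁺` it would exceed `L` at times arbitrarily close after
`q`, hence before `b`. -/
theorem lt_of_forall_le_of_mem_setUPlus (hU : ω ∈ setUPlus L) {a b : ℝ≥0}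
    (h : ∀ q, a < q → q < b → ω q ≤ L) {q : ℝ≥0} (haq : a < q) (hqb : q < b) : ω q < L := by
  by_contra! hq
  have h1 : infTime {t | q ≤ t ∧ L ≤ ω t} < b :=
    infTime_lt_iff.2 ⟨q, ⟨le_rfl, hq⟩, by exact_mod_cast hqb⟩
  rw [hU q] at h1
  obtain ⟨r, ⟨hqr, hr⟩, hrb⟩ := infTime_lt_iff.1 h1
  exact absurd (h r (haq.trans_le hqr) (by exact_mod_cast hrb)) (not_le.2 hr)

theorem eventually_lt_parisianTime (hd : 0 < d) (hV : ω ∈ setV L) (hW : ω ∈ setW L d)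
    (hU : ω ∈ setUPlus L) {t : ℝ≥0} (h : t < parisianTime L d ω) :
    ∀ᶠ ω' in 𝓝 ω, t < parisianTime L d ω' := by
  by_contra hcon
  have hcon' : ∀ n : ℕ, ∃ l : ℝ≥0 ≃o ℝ≥0, ∃ ω' : CadlagPath, ∃ s ≤ t, BelowDuring L d ω' s ∧
      ∀ q ≤ t, dist (l q) q < 1 / ((n : ℝ) + 1) ∧ dist (ω q) (ω' (l q)) < 1 / ((n : ℝ) + 1) := by
    intro n
    by_contra! hn
    refine hcon (eventually_nhds_iff.2 ⟨t, 1 / ((n : ℝ) + 1), by positivity, ?_⟩)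
    rintro ω' ⟨l, hl⟩
    by_contra hle
    obtain ⟨s, hst, hs⟩ := (parisianTime_le_iff hd).1 (not_lt.1 hle)
    obtain ⟨q, hqt, hq⟩ := hn l ω' s hst hs
    exact absurd (hl q hqt).2 (not_lt.2 (hq (hl q hqt).1))
  choose l ω' s hst hs hl using hcon'
  obtain ⟨s₀, ⟨-, hs₀t⟩, φ, hφ, hlim⟩ :=
    (isCompact_Icc (a := (0 : ℝ≥0)) (b := t)).tendsto_subseq fun n => ⟨zero_le, hst n⟩
  have hds : d ≤ s₀ := ge_of_tendsto' hlim fun n => (hs (φ n)).1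
  obtain ⟨e, rfl⟩ := exists_add_of_le hds
  have h0 : Tendsto (fun n => 1 / ((φ n : ℝ) + 1)) atTop (𝓝 0) :=
    tendsto_one_div_add_atTop_nhds_zero_nat.comp hφ.tendsto_atTop
  -- An interior point `q` of the limit window is carried by `l (φ n)` into the window of `ω' (φ n)`
  -- for large `n`; strictness is lost in the limit.
  have hle : ∀ q, e < q → q < d + e → ω q ≤ L := by
    intro q hq1 hq2
    have hqt := hq2.le.trans hs₀t
    have hlq : Tendsto (fun n => l (φ n) q) atTop (𝓝 q) :=
      tendsto_iff_dist_tendsto_zero.2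
        (squeeze_zero (fun n => dist_nonneg) (fun n => (hl (φ n) q hqt).1.le) h0)
    have hωq : Tendsto (fun n => ω' (φ n) (l (φ n) q)) atTop (𝓝 (ω q)) := by
      refine tendsto_iff_dist_tendsto_zero.2
        (squeeze_zero (fun n => dist_nonneg) (fun n => ?_) h0)
      rw [dist_comm]
      exact (hl (φ n) q hqt).2.le
    refine le_of_tendsto hωq ?_
    have h1 : d + e < q + d := by
      rw [add_comm q]
      gcongr
    filter_upwards [hlim.eventually_lt (hlq.add_const d) h1, hlq.eventually_lt hlim hq2]
      with n h2 h3
    exact ((hs (φ n)).2 _ h2 h3.le).le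
  have hlt : ∀ q, e < q → q < d + e → ω q < L := fun q h1 h2 =>
    lt_of_forall_le_of_mem_setUPlus hU hle h1 h2
  have hnone : ∀ r ≤ t, ¬ BelowDuring L d ω r := fun r hr hB =>
    absurd ((parisianTime_le_iff hd).2 ⟨r, hr, hB⟩) (not_le.2 h)
  have he : e < d + e := lt_add_of_pos_left e hd
  have hend : L ≤ ω (d + e) := by
    by_contra! hend
    refine hnone _ hs₀t ⟨hds, fun r h1 h2 => ?_⟩
    rcases h2.eq_or_lt with rfl | h2
    · exact hend
    · exact hlt r (by rwa [add_comm, add_lt_add_iff_right] at h1) h2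
  -- Otherwise the excursion began before `e`, and the window moved left to end at `d + v` would
  -- already have length `d`.
  have hstart : ∀ u < e, ∃ q, u < q ∧ q ≤ e ∧ L ≤ ω q := by
    intro u hu
    by_contra! hq
    obtain ⟨v, huv, hve⟩ := exists_between hu
    have hvt : d + v ≤ t := (by gcongr : d + v ≤ d + e).trans hs₀t
    refine hnone (d + v) hvt ⟨le_self_add, fun r h1 h2 => ?_⟩
    rw [add_comm, add_lt_add_iff_right] at h1
    rcases le_or_gt r e with h3 | h3
    · exact hq r (huv.trans h1) h3
    · exact hlt r h3 (h2.trans_lt (by gcongr))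
  obtain ⟨k, hk1, hk2⟩ := exists_sigma_eq hV.2 he hlt hend hstart
  refine hW k ?_
  rw [hk1, hk2, ← ENNReal.coe_sub, add_tsub_cancel_right, ENNReal.ofReal_coe_nnreal]

theorem continuousAt_eval {t : ℝ≥0} (h : ContinuousAt ω t) :
    ContinuousAt (fun ω' : CadlagPath => ω' t) ω := by
  refine Metric.continuousAt_iff'.2 fun ε hε => ?_
  obtain ⟨δ, hδ, hball⟩ := Metric.continuousAt_iff.1 h (ε / 2) (half_pos hε)
  -- The basis in the other variable makes the time change act on the fixed path `ω`, whose
  -- continuity at `t` is known.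
  refine (nhds_basis_uniformity hasBasis_uniformity).eventually_iff.2
    ⟨(t, min (ε / 2) δ), lt_min (half_pos hε) hδ, ?_⟩
  rintro ω' ⟨l, hl⟩
  obtain ⟨h1, h2⟩ := hl t le_rfl
  have h3 := hball (h1.trans_le (min_le_right _ _))
  have h4 := h2.trans_le (min_le_left _ _)
  linarith [dist_triangle (ω' t) (ω (l t)) (ω t)]

theorem continuousAt_indicator_parisianTime (hd : 0 < d) (hV : ω ∈ setV L) (hW : ω ∈ setW L d)
    (hU : ω ∈ setUPlus L) (hN : NoLeftTouch L ω) {t : ℝ≥0} (ht : parisianTime L d ω ≠ t)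
    (hc : ContinuousAt ω t) {f : ℝ → ℝ} (hf : ContinuousAt f (ω t)) :
    ContinuousAt (fun ω' : CadlagPath =>
      {ω' : CadlagPath | parisianTime L d ω' ≤ t}.indicator (fun ω' => f (ω' t)) ω') ω := by
  rcases ht.lt_or_gt with h | h
  · have h1 : ContinuousAt (fun ω' : CadlagPath => f (ω' t)) ω :=
      ContinuousAt.comp (g := f) (f := fun ω' : CadlagPath => ω' t) hf (continuousAt_eval hc)
    refine h1.congr ?_
    filter_upwards [eventually_parisianTime_le hd hN h] with ω' hω'
    exact (Set.indicator_of_mem (s := {ω' : CadlagPath | parisianTime L d ω' ≤ t}) hω'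
      fun ω' : CadlagPath => f (ω' t)).symm
  · refine (continuousAt_const (x := ω) (y := (0 : ℝ))).congr ?_
    filter_upwards [eventually_lt_parisianTime hd hV hW hU h] with ω' hω'
    exact (Set.indicator_of_notMem (s := {ω' : CadlagPath | parisianTime L d ω' ≤ t})
      (not_le.2 hω') fun ω' : CadlagPath => f (ω' t)).symm

end CadlagPath

/-! ### Measurability along finite-state chains -/

namespace CadlagPath

open TopologicalSpace (denseSeq denseRange_denseSeq)

variable {L : ℝ} {d : ℝ≥0} {ω : CadlagPath}

/-- By right continuity the path stays below `L` a little after `s`, so the window can slide right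
to a dense time. -/
theorem BelowDuring.exists_denseSeq {s t : ℝ≥0} (hd : 0 < d) (h : BelowDuring L d ω s)
    (hst : s < t) : ∃ n, denseSeq ℝ≥0 n ≤ t ∧ BelowDuring L d ω (denseSeq ℝ≥0 n) := by
  obtain ⟨b, hsb, hb⟩ := exists_forall_Ico_lt (h.2 s (lt_add_of_pos_right s hd) le_rfl)
  obtain ⟨_, ⟨n, rfl⟩, h1, h2⟩ := (denseRange_denseSeq ℝ≥0).exists_between (lt_min hsb hst)
  refine ⟨n, h2.le.trans (min_le_right _ _), h.1.trans h1.le, fun r h3 h4 => ?_⟩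
  rcases le_total r s with h5 | h5
  · exact h.2 r (h1.trans h3) h5
  · exact hb r h5 (h4.trans_lt (h2.trans_le (min_le_left _ _)))

theorem parisianTime_le_iff_denseSeq (hd : 0 < d) {t : ℝ≥0} :
    parisianTime L d ω ≤ t ↔ BelowDuring L d ω t ∨
      ∃ n, denseSeq ℝ≥0 n ≤ t ∧ BelowDuring L d ω (denseSeq ℝ≥0 n) := by
  rw [parisianTime_le_iff hd]
  constructor
  · rintro ⟨s, hst, hs⟩
    rcases hst.eq_or_lt with rfl | hst
    · exact .inl hs
    · exact .inr (hs.exists_denseSeq hd hst)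
  · rintro (h | ⟨n, h1, h2⟩)
    · exact ⟨t, le_rfl, h⟩
    · exact ⟨_, h1, h2⟩

theorem exists_forall_Ico_eq {S : Finset ℝ} (hS : ∀ t, ω t ∈ S) (s : ℝ≥0) :
    ∃ b, s < b ∧ ∀ r, s ≤ r → r < b → ω r = ω s := by
  classical
  have h1 : ((S.erase (ω s) : Finset ℝ) : Set ℝ)ᶜ ∈ 𝓝 (ω s) :=
    (Finset.finite_toSet _).isClosed.isOpen_compl.mem_nhds (by simp)
  obtain ⟨b, hb, hsub⟩ := mem_nhdsGE_iff_exists_Ico_subset.1 (ω.rightCts s h1)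
  refine ⟨b, hb, fun r h2 h3 => ?_⟩
  have h4 := hsub ⟨h2, h3⟩
  by_contra hne
  exact h4 (by simpa using ⟨hS r, hne⟩)

/-- A path with values in a finite set is constant to the right of each time, so the strict bound
passes from dense times to all times; for a general càdlàg path only `≤ L` would survive. -/
theorem belowDuring_iff_denseSeq {S : Finset ℝ} (hS : ∀ t, ω t ∈ S) (hd : 0 < d) {s : ℝ≥0} :
    BelowDuring L d ω s ↔ d ≤ s ∧ ω s < L ∧
      ∀ n, s < denseSeq ℝ≥0 n + d → denseSeq ℝ≥0 n ≤ s → ω (denseSeq ℝ≥0 n) < L := by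
  constructor
  · rintro ⟨h1, h2⟩
    exact ⟨h1, h2 s (lt_add_of_pos_right s hd) le_rfl, fun n => h2 _⟩
  · rintro ⟨h1, h2, h3⟩
    refine ⟨h1, fun r hr hrs => ?_⟩
    rcases hrs.eq_or_lt with rfl | hrs
    · exact h2
    obtain ⟨b, hrb, hb⟩ := exists_forall_Ico_eq hS r
    obtain ⟨_, ⟨n, rfl⟩, h4, h5⟩ := (denseRange_denseSeq ℝ≥0).exists_between (lt_min hrb hrs)
    rw [← hb _ h4.le (h5.trans_le (min_le_left _ _))]
    exact h3 n (hr.trans (by gcongr)) (h5.le.trans (min_le_right _ _))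

variable {Ω : Type*} {mΩ : MeasurableSpace Ω} {P : Measure Ω} {S : Finset ℝ} {Y : Ω → CadlagPath}

theorem nullMeasurableSet_belowDuring (hY : ∀ t, Measurable fun ω => Y ω t)
    (hS : ∀ᵐ ω ∂P, ∀ t, Y ω t ∈ S) (hd : 0 < d) (s : ℝ≥0) :
    NullMeasurableSet {ω | BelowDuring L d (Y ω) s} P := by
  have hlt : ∀ t, MeasurableSet {ω | Y ω t < L} := fun t => measurableSet_lt (hY t) measurable_const
  have h : MeasurableSet {ω | d ≤ s ∧ Y ω s < L ∧
      ∀ n, s < denseSeq ℝ≥0 n + d → denseSeq ℝ≥0 n ≤ s → Y ω (denseSeq ℝ≥0 n) < L} := by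
    refine (MeasurableSet.const _).inter ((hlt s).inter ?_)
    change MeasurableSet {ω | ∀ n, s < denseSeq ℝ≥0 n + d → denseSeq ℝ≥0 n ≤ s →
      Y ω (denseSeq ℝ≥0 n) < L}
    simp only [Set.ofPred_forall]
    exact .iInter fun n => .iInter fun _ => .iInter fun _ => hlt _
  refine h.nullMeasurableSet.congr ?_
  filter_upwards [hS] with ω hω
  exact propext (belowDuring_iff_denseSeq hω hd).symm

theorem nullMeasurableSet_parisianTime_le (hY : ∀ t, Measurable fun ω => Y ω t)
    (hS : ∀ᵐ ω ∂P, ∀ t, Y ω t ∈ S) (hd : 0 < d) (t : ℝ≥0) :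
    NullMeasurableSet {ω | parisianTime L d (Y ω) ≤ t} P := by
  simp only [parisianTime_le_iff_denseSeq hd, Set.ofPred_or, Set.ofPred_exists, Set.ofPred_and]
  exact (nullMeasurableSet_belowDuring hY hS hd t).union (.iUnion fun n =>
    (MeasurableSet.const _).nullMeasurableSet.inter (nullMeasurableSet_belowDuring hY hS hd _))

/-- No measurability of `f` is needed: only its values on the finite set `S` matter. -/
theorem aemeasurable_comp_eval (hY : ∀ t, Measurable fun ω => Y ω t)
    (hS : ∀ᵐ ω ∂P, ∀ t, Y ω t ∈ S) (f : ℝ → ℝ) (t : ℝ≥0) :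
    AEMeasurable (fun ω => f (Y ω t)) P := by
  have h : Measurable ((S : Set ℝ).indicator f) := by
    refine measurable_zero.measurable_of_countable_ne (S.countable_toSet.mono fun x hx => ?_)
    by_contra hxS
    exact hx (Set.indicator_of_notMem hxS f).symm
  refine (h.comp (hY t)).aemeasurable.congr ?_
  filter_upwards [hS] with ω hω
  exact Set.indicator_of_mem (hω t) f

theorem aemeasurable_indicator_parisianTime (hY : ∀ t, Measurable fun ω => Y ω t)
    (hS : ∀ᵐ ω ∂P, ∀ t, Y ω t ∈ S) (hd : 0 < d) (f : ℝ → ℝ) (t : ℝ≥0) :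
    AEMeasurable ({ω | parisianTime L d (Y ω) ≤ t}.indicator fun ω => f (Y ω t)) P :=
  (aemeasurable_comp_eval hY hS f t).indicator₀ (nullMeasurableSet_parisianTime_le hY hS hd t)

end CadlagPath

/-! ### Optional times and optional sampling -/

section OptionalTimes

variable {Ω : Type*} {mΩ : MeasurableSpace Ω} {P : Measure Ω} {ℱ : Filtration ℝ≥0 mΩ}
  {τ : Ω → ℝ≥0}

/-- `τ` is an optional time: `{τ < t} ∈ ℱ t` for all `t`. -/
def IsOptionalTime (ℱ : Filtration ℝ≥0 mΩ) (τ : Ω → ℝ≥0) : Prop :=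
  ∀ t, MeasurableSet[ℱ t] {ω | τ ω < t}

theorem IsOptionalTime.measurable (hτ : IsOptionalTime ℱ τ) : Measurable τ :=
  measurable_of_Iio fun t => ℱ.le t _ (hτ t)

theorem isOptionalTime_const (t : ℝ≥0) : IsOptionalTime ℱ fun _ => t :=
  fun _ => MeasurableSet.const _

theorem isOptionalTime_iSup {τ : ℕ → Ω → ℝ≥0} (hτ : ∀ n, IsOptionalTime ℱ (τ n))
    (hb : ∀ ω, BddAbove (Set.range fun n => τ n ω)) :
    IsOptionalTime ℱ fun ω => ⨆ n, τ n ω := by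
  intro t
  have h : {ω | ⨆ n, τ n ω < t} = ⋃ j : ℕ, ⋃ _ : TopologicalSpace.denseSeq ℝ≥0 j < t,
      ⋂ n, {ω | τ n ω < TopologicalSpace.denseSeq ℝ≥0 j} := by
    ext ω
    simp only [Set.mem_ofPred_eq, Set.mem_iUnion, Set.mem_iInter, exists_prop]
    constructor
    · intro h
      obtain ⟨_, ⟨j, rfl⟩, h1, h2⟩ :=
        (TopologicalSpace.denseRange_denseSeq ℝ≥0).exists_between h
      exact ⟨j, h2, fun n => (le_ciSup (hb ω) n).trans_lt h1⟩
    · rintro ⟨j, h1, h2⟩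
      exact (ciSup_le fun n => (h2 n).le).trans_lt h1
  rw [h]
  exact .iUnion fun j => .iUnion fun hj => .iInter fun n => ℱ.mono hj.le _ (hτ n _)

/-- The least multiple of `1 / (m + 1)` that is larger than `x`. -/
noncomputable def gridAbove (m : ℕ) (x : ℝ≥0) : ℝ≥0 := (⌊(m + 1) * x⌋₊ + 1) / (m + 1)

theorem lt_gridAbove (m : ℕ) (x : ℝ≥0) : x < gridAbove m x := by
  rw [gridAbove, lt_div_iff₀ (by positivity), mul_comm]
  exact Nat.lt_floor_add_one _

theorem gridAbove_le (m : ℕ) (x : ℝ≥0) : gridAbove m x ≤ x + 1 / (m + 1) := by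
  rw [gridAbove, add_div]
  gcongr
  rw [div_le_iff₀ (by positivity), mul_comm x]
  exact Nat.floor_le zero_le

theorem gridAbove_le_add_one (m : ℕ) {x K : ℝ≥0} (h : x ≤ K) : gridAbove m x ≤ K + 1 := by
  refine (gridAbove_le m x).trans (add_le_add h ?_)
  rw [div_le_iff₀ (by positivity)]
  simp

theorem tendsto_gridAbove (x : ℝ≥0) : Tendsto (fun m => gridAbove m x) atTop (𝓝[≥] x) := by
  refine tendsto_nhdsWithin_iff.2 ⟨?_, .of_forall fun m => (lt_gridAbove m x).le⟩
  refine tendsto_of_tendsto_of_tendsto_of_le_of_le tendsto_const_nhds ?_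
    (fun m => (lt_gridAbove m x).le) (fun m => gridAbove_le m x)
  simpa using (tendsto_const_nhds (x := x)).add
    (tendsto_one_div_add_atTop_nhds_zero_nat (𝕜 := ℝ≥0))

theorem measurable_sampled_gridAbove {Z : ℝ≥0 → Ω → ℝ} (hZ : ∀ t, Measurable (Z t))
    (hτ : Measurable τ) (m : ℕ) : Measurable fun ω => Z (gridAbove m (τ ω)) ω := by
  have h1 : Measurable fun p : Ω × ℕ => Z (((p.2 : ℝ≥0) + 1) / (m + 1)) p.1 :=
    measurable_from_prod_countable_left fun j => hZ ((j + 1) / (m + 1))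
  have h2 : Measurable fun ω => ⌊((m : ℝ≥0) + 1) * τ ω⌋₊ :=
    Nat.measurable_floor.comp (hτ.const_mul _)
  exact Measurable.comp (g := fun p : Ω × ℕ => Z (((p.2 : ℝ≥0) + 1) / (m + 1)) p.1)
    (f := fun ω => (ω, ⌊((m : ℝ≥0) + 1) * τ ω⌋₊)) h1 (measurable_id.prodMk h2)

theorem aemeasurable_sampled {Z : ℝ≥0 → Ω → ℝ} (hZ : ∀ t, Measurable (Z t))
    (hrc : ∀ᵐ ω ∂P, ∀ t, ContinuousWithinAt (fun s => Z s ω) (Set.Ici t) t)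
    (hτ : Measurable τ) : AEMeasurable (fun ω => Z (τ ω) ω) P := by
  refine aemeasurable_of_tendsto_metrizable_ae (f := fun m ω => Z (gridAbove m (τ ω)) ω) atTop
    (fun m => (measurable_sampled_gridAbove hZ hτ m).aemeasurable) ?_
  filter_upwards [hrc] with ω hω
  exact (hω (τ ω)).tendsto.comp (tendsto_gridAbove _)

/-- This is the event `j / (m + 1) ≤ τ < (j + 1) / (m + 1)`, decided by the time `(j + 1) / (m + 1)`
that `gridAbove` assigns to it. -/
theorem IsOptionalTime.measurableSet_floor_eq (hτ : IsOptionalTime ℱ τ) (m j : ℕ) :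
    MeasurableSet[ℱ ((j + 1) / (m + 1))] {ω | ⌊((m : ℝ≥0) + 1) * τ ω⌋₊ = j} := by
  have h : {ω | ⌊((m : ℝ≥0) + 1) * τ ω⌋₊ = j} =
      {ω | τ ω < (j + 1) / (m + 1)} \ {ω | τ ω < j / (m + 1)} := by
    ext ω
    simp only [Set.mem_ofPred_eq, Set.mem_sdiff, not_lt]
    rw [Nat.floor_eq_iff zero_le, lt_div_iff₀ (by positivity), div_le_iff₀ (by positivity),
      mul_comm (τ ω), and_comm]
  rw [h]
  refine (hτ _).diff (ℱ.mono ?_ _ (hτ _))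
  gcongr
  exact le_self_add

/-- Optional sampling at finitely many values, by the martingale property on each event of
constancy. The horizon is `K + 1` because rounding up may pass `K`. -/
theorem MeasureTheory.Martingale.integral_gridAbove [IsFiniteMeasure P] {M : ℝ≥0 → Ω → ℝ}
    (hM : Martingale M ℱ P) (hτ : IsOptionalTime ℱ τ) {K : ℝ≥0} (hK : ∀ ω, τ ω ≤ K) (m : ℕ) :
    ∫ ω, M (gridAbove m (τ ω)) ω ∂P = ∫ ω, M (K + 1) ω ∂P := by
  set A : ℕ → Set Ω := fun j => {ω | ⌊((m : ℝ≥0) + 1) * τ ω⌋₊ = j} with hA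
  set N := ⌊((m : ℝ≥0) + 1) * K⌋₊ + 1 with hN
  have hAm : ∀ j, MeasurableSet (A j) := fun j => ℱ.le _ _ (hτ.measurableSet_floor_eq m j)
  have hdec : ∀ (g : ℕ → Ω → ℝ) ω,
      g ⌊((m : ℝ≥0) + 1) * τ ω⌋₊ ω = ∑ j ∈ Finset.range N, (A j).indicator (g j) ω := by
    intro g ω
    have hmem : ⌊((m : ℝ≥0) + 1) * τ ω⌋₊ ∈ Finset.range N := by
      rw [Finset.mem_range, hN, Nat.lt_succ_iff]
      gcongr
      exact hK ω
    rw [Finset.sum_eq_single_of_mem _ hmem, Set.indicator_of_mem (by simp [hA])]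
    intro j _ hj
    exact Set.indicator_of_notMem (s := A j) (fun h => hj (Eq.symm h)) (g j)
  have hsum : ∀ g : ℕ → Ω → ℝ, (∀ j, Integrable (g j) P) →
      ∫ ω, g ⌊((m : ℝ≥0) + 1) * τ ω⌋₊ ω ∂P = ∑ j ∈ Finset.range N, ∫ ω in A j, g j ω ∂P := by
    intro g hg
    simp_rw [hdec g]
    rw [integral_finsetSum _ fun j _ => (hg j).indicator (hAm j)]
    exact Finset.sum_congr rfl fun j _ => integral_indicator (hAm j)
  calc ∫ ω, M (gridAbove m (τ ω)) ω ∂P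
      = ∑ j ∈ Finset.range N, ∫ ω in A j, M ((j + 1) / (m + 1)) ω ∂P :=
        hsum (fun j => M ((j + 1) / (m + 1))) fun j => hM.integrable _
    _ = ∑ j ∈ Finset.range N, ∫ ω in A j, M (K + 1) ω ∂P := by
        refine Finset.sum_congr rfl fun j hj => hM.setIntegral_eq ?_ (hτ.measurableSet_floor_eq m j)
        have h1 : (j : ℝ≥0) ≤ (m + 1) * K :=
          (Nat.cast_le.2 (Nat.lt_succ_iff.1 (Finset.mem_range.1 hj))).trans
            (Nat.floor_le zero_le)
        rw [div_le_iff₀ (by positivity), add_mul, mul_comm K, one_mul]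
        gcongr
        exact le_add_self
    _ = ∫ ω, M (K + 1) ω ∂P := (hsum (fun _ => M (K + 1)) fun _ => hM.integrable _).symm

/-- Optional sampling for bounded optional times and right-continuous martingales that are
dominated on bounded intervals. -/
theorem MeasureTheory.Martingale.integral_sampled [IsFiniteMeasure P] {M : ℝ≥0 → Ω → ℝ}
    (hM : Martingale M ℱ P) (hτ : IsOptionalTime ℱ τ) {K : ℝ≥0} (hK : ∀ ω, τ ω ≤ K)
    (hrc : ∀ᵐ ω ∂P, ∀ t, ContinuousWithinAt (fun s => M s ω) (Set.Ici t) t)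
    {B : Ω → ℝ} (hB : Integrable B P) (hMB : ∀ᵐ ω ∂P, ∀ t ≤ K + 1, |M t ω| ≤ B ω) :
    ∫ ω, M (τ ω) ω ∂P = ∫ ω, M (K + 1) ω ∂P := by
  have hlim : Tendsto (fun m => ∫ ω, M (gridAbove m (τ ω)) ω ∂P) atTop
      (𝓝 (∫ ω, M (τ ω) ω ∂P)) := by
    refine tendsto_integral_of_dominated_convergence B (fun m => ?_) hB (fun m => ?_) ?_
    · exact (measurable_sampled_gridAbove (fun t => ((hM.1 t).mono (ℱ.le t)).measurable)
        hτ.measurable m).aestronglyMeasurable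
    · filter_upwards [hMB] with ω hω
      exact hω _ (gridAbove_le_add_one m (hK ω))
    · filter_upwards [hrc] with ω hω
      exact (hω (τ ω)).tendsto.comp (tendsto_gridAbove _)
  simp_rw [hM.integral_gridAbove hτ hK] at hlim
  exact tendsto_nhds_unique hlim tendsto_const_nhds

end OptionalTimes

/-! ### Test functions on an interval -/

section TestFunctions

variable {I : Set ℝ}

/-- On each side of `x`, either `I` contains a further point and the segment up to it, or `x` is an
endpoint belonging to `I`. -/
theorem Set.OrdConnected.exists_isCompact_inter_Icc (hI : I.OrdConnected) {x : ℝ} (hx : x ∈ I) :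
    ∃ a < x, ∃ b > x, IsCompact (I ∩ Set.Icc a b) := by
  have hl : ∃ a < x, IsCompact (I ∩ Set.Icc a x) := by
    by_cases h : ∃ y ∈ I, y < x
    · obtain ⟨y, hy, hyx⟩ := h
      exact ⟨y, hyx, by rw [Set.inter_eq_right.2 (hI.out hy hx)]; exact isCompact_Icc⟩
    · push Not at h
      refine ⟨x - 1, by linarith, ?_⟩
      convert isCompact_singleton (x := x)
      ext z
      exact ⟨fun hz => le_antisymm hz.2.2 (h z hz.1), fun hz => by
        rw [Set.mem_singleton_iff.1 hz]; exact ⟨hx, by linarith, le_rfl⟩⟩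
  have hr : ∃ b > x, IsCompact (I ∩ Set.Icc x b) := by
    by_cases h : ∃ y ∈ I, x < y
    · obtain ⟨y, hy, hyx⟩ := h
      exact ⟨y, hyx, by rw [Set.inter_eq_right.2 (hI.out hx hy)]; exact isCompact_Icc⟩
    · push Not at h
      refine ⟨x + 1, by linarith, ?_⟩
      convert isCompact_singleton (x := x)
      ext z
      exact ⟨fun hz => le_antisymm (h z hz.1) hz.2.1, fun hz => by
        rw [Set.mem_singleton_iff.1 hz]; exact ⟨hx, le_rfl, by linarith⟩⟩
  obtain ⟨a, ha, hac⟩ := hl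
  obtain ⟨b, hb, hbc⟩ := hr
  refine ⟨a, ha, b, hb, ?_⟩
  rw [← Set.Icc_union_Icc_eq_Icc ha.le hb.le, Set.inter_union_distrib_left]
  exact hac.union hbc

theorem isTestFunction_zero : IsTestFunction I 0 where
  contDiff := contDiff_const
  hasCompactSupport := HasCompactSupport.zero
  isCompact_inter := by simp

/-- There are countably many nonnegative test functions that separate the points of `I` from
closed sets. -/
theorem exists_testFunctions (hI : I.OrdConnected) :
    ∃ F : ℚ × ℚ → ℝ → ℝ, (∀ p, IsTestFunction I (F p)) ∧ (∀ p x, 0 ≤ F p x) ∧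
      ∀ x ∈ I, ∀ O, IsOpen O → x ∈ O → ∃ p, 0 < F p x ∧ tsupport (F p) ⊆ O := by
  have hex : ∀ p : ℚ × ℚ, ∃ g : ℝ → ℝ, IsTestFunction I g ∧ (∀ x, 0 ≤ g x) ∧
      (0 < p.2 → IsCompact (I ∩ Metric.closedBall (p.1 : ℝ) p.2) →
        (∀ x ∈ Metric.ball (p.1 : ℝ) p.2, 0 < g x) ∧
        tsupport g = Metric.closedBall (p.1 : ℝ) p.2) := by
    rintro ⟨c, r⟩
    by_cases h : 0 < r ∧ IsCompact (I ∩ Metric.closedBall (c : ℝ) r)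
    · obtain ⟨hr, hc⟩ := h
      have hr' : (0 : ℝ) < r := by exact_mod_cast hr
      let b : ContDiffBump (c : ℝ) := ⟨r / 2, r, by positivity, by linarith⟩
      have hb : tsupport b = Metric.closedBall (c : ℝ) r := b.tsupport_eq
      refine ⟨b, ⟨b.contDiff, b.hasCompactSupport, by rwa [hb]⟩, fun x => b.nonneg, fun _ _ =>
        ⟨fun x hx => b.pos_of_mem_ball hx, hb⟩⟩
    · exact ⟨0, isTestFunction_zero, fun _ => le_rfl, fun h1 h2 => (h ⟨h1, h2⟩).elim⟩
  choose F hF1 hF2 hF3 using hex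
  refine ⟨F, hF1, hF2, fun x hx O hO hxO => ?_⟩
  obtain ⟨a, ha, b, hb, hab⟩ := hI.exists_isCompact_inter_Icc hx
  obtain ⟨ε, hε, hball⟩ := Metric.isOpen_iff.1 hO x hxO
  have hδ : 0 < min ε (min (x - a) (b - x)) / 2 := by
    have := lt_min hε (lt_min (sub_pos.2 ha) (sub_pos.2 hb))
    positivity
  obtain ⟨r, hr0, hr⟩ := exists_rat_btwn hδ
  have h1 : min ε (min (x - a) (b - x)) ≤ ε := min_le_left _ _
  have h2 : min ε (min (x - a) (b - x)) ≤ x - a := (min_le_right _ _).trans (min_le_left _ _)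
  have h3 : min ε (min (x - a) (b - x)) ≤ b - x := (min_le_right _ _).trans (min_le_right _ _)
  -- With `x - r < c < x`, the ball of radius `r` about `c` contains `x` and its closure stays
  -- within `2r` of `x`.
  obtain ⟨c, hc1, hc2⟩ := exists_rat_btwn (sub_lt_self x hr0)
  have hsub : ∀ y ∈ Metric.closedBall (c : ℝ) r, dist y x < ε ∧ y ∈ Set.Icc a b := by
    intro y hy
    rw [Metric.mem_closedBall, Real.dist_eq, abs_le] at hy
    rw [Real.dist_eq, abs_lt]
    exact ⟨⟨by linarith [hy.1], by linarith [hy.2]⟩, by linarith [hy.1], by linarith [hy.2]⟩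
  have hcomp : IsCompact (I ∩ Metric.closedBall (c : ℝ) r) := by
    have h4 : I ∩ Metric.closedBall (c : ℝ) r =
        (I ∩ Set.Icc a b) ∩ Metric.closedBall (c : ℝ) r := by
      ext y
      exact ⟨fun h => ⟨⟨h.1, (hsub y h.2).2⟩, h.2⟩, fun h => ⟨h.1.1, h.2⟩⟩
    rw [h4]
    exact hab.inter_right Metric.isClosed_closedBall
  obtain ⟨h5, h6⟩ := hF3 (c, r) (by exact_mod_cast hr0) hcomp
  refine ⟨(c, r), h5 x ?_, ?_⟩
  · rw [Metric.mem_ball, Real.dist_eq, abs_lt]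
    constructor <;> linarith
  · rw [h6]
    exact fun y hy => hball (hsub y hy).1

end TestFunctions

/-! ### Dynkin's formula and quasi-left-continuity -/

section MartingaleProblem

variable {Ω : Type*} {mΩ : MeasurableSpace Ω} {P : Measure Ω}
  {ℱ : Filtration ℝ≥0 mΩ} {I : Set ℝ} {μ σ : ℝ → ℝ} {ν : Kernel ℝ ℝ} {X : Ω → CadlagPath}
  {f : ℝ → ℝ}

/-- The compensator `∫_0^t 𝒢f(X_s) ds` of `f(X_t)`. -/
noncomputable def compensator (μ σ : ℝ → ℝ) (ν : Kernel ℝ ℝ) (X : Ω → CadlagPath) (f : ℝ → ℝ)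
    (t : ℝ≥0) (ω : Ω) : ℝ :=
  ∫ s in (0 : ℝ)..t, generator μ σ ν f (X ω s.toNNReal)

theorem IsTestFunction.exists_abs_le (hf : IsTestFunction I f) : ∃ C, ∀ x, |f x| ≤ C :=
  hf.hasCompactSupport.exists_bound_of_continuous hf.contDiff.continuous

theorem HasGenerator.measurable_eval (hX : HasGenerator P ℱ I μ σ ν X) (t : ℝ≥0) :
    Measurable fun ω => X ω t :=
  (hX.adapted t).mono (ℱ.le t) le_rfl

theorem HasGenerator.martingale_sub (hX : HasGenerator P ℱ I μ σ ν X)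
    (hf : IsTestFunction I f) :
    Martingale (fun t ω => f (X ω t) - compensator μ σ ν X f t ω) ℱ P :=
  hX.martingale f hf

/-- The compensator is the difference of `f(X_t)` and the martingale, both measurable. -/
theorem HasGenerator.measurable_compensator (hX : HasGenerator P ℱ I μ σ ν X)
    (hf : IsTestFunction I f) (t : ℝ≥0) : Measurable (compensator μ σ ν X f t) := by
  have h1 : Measurable fun ω => f (X ω t) :=
    hf.contDiff.continuous.measurable.comp (hX.measurable_eval t)
  have h2 := (((hX.martingale_sub hf).1 t).mono (ℱ.le t)).measurable
  convert h1.sub h2 using 1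
  ext ω
  simp

theorem HasGenerator.aemeasurable_comp_sampled (hX : HasGenerator P ℱ I μ σ ν X)
    (hf : IsTestFunction I f) {τ : Ω → ℝ≥0} (hτ : Measurable τ) :
    AEMeasurable (fun ω => f (X ω (τ ω))) P :=
  aemeasurable_sampled (Z := fun t ω => f (X ω t))
    (fun t => hf.contDiff.continuous.measurable.comp (hX.measurable_eval t))
    (.of_forall fun ω t => hf.contDiff.continuous.continuousAt.comp_continuousWithinAt
      ((X ω).rightCts t)) hτ

variable [IsProbabilityMeasure P]

theorem HasGenerator.ae_integrableOn (hX : HasGenerator P ℱ I μ σ ν X)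
    (hf : IsTestFunction I f) : ∀ᵐ ω ∂P, ∀ t : ℝ≥0,
      IntegrableOn (fun s : ℝ => generator μ σ ν f (X ω s.toNNReal)) (Set.Icc 0 (t : ℝ)) := by
  have h : ∀ᵐ ω ∂P, ∀ n : ℕ, IntegrableOn
      (fun s : ℝ => generator μ σ ν f (X ω s.toNNReal)) (Set.Icc 0 (((n : ℝ≥0) : ℝ≥0) : ℝ)) :=
    ae_all_iff.2 fun n => (hX.integrable_generator f hf n).prod_right_ae
  filter_upwards [h] with ω hω t
  obtain ⟨n, hn⟩ := exists_nat_ge t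
  exact (hω n).mono_set (Set.Icc_subset_Icc_right (by exact_mod_cast hn))

theorem HasGenerator.ae_continuous_compensator (hX : HasGenerator P ℱ I μ σ ν X)
    (hf : IsTestFunction I f) :
    ∀ᵐ ω ∂P, Continuous fun t => compensator μ σ ν X f t ω := by
  filter_upwards [hX.ae_integrableOn hf] with ω hω
  refine continuous_iff_continuousAt.2 fun t => ?_
  have ht : (0 : ℝ) ≤ (t + 1 : ℝ≥0) := NNReal.coe_nonneg _
  have h1 : ContinuousOn
      (fun x : ℝ => ∫ s in (0 : ℝ)..x, generator μ σ ν f (X ω s.toNNReal))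
      (Set.uIcc 0 ((t + 1 : ℝ≥0) : ℝ)) :=
    intervalIntegral.continuousOn_primitive_interval (by rw [Set.uIcc_of_le ht]; exact hω _)
  rw [Set.uIcc_of_le ht] at h1
  refine (h1 t ⟨NNReal.coe_nonneg _, by simp⟩).tendsto.comp
    (tendsto_nhdsWithin_iff.2 ⟨NNReal.continuous_coe.continuousAt, ?_⟩)
  filter_upwards [gt_mem_nhds (lt_add_one t)] with s hs
  exact ⟨NNReal.coe_nonneg _, NNReal.coe_le_coe.2 hs.le⟩

theorem HasGenerator.exists_compensator_bound (hX : HasGenerator P ℱ I μ σ ν X)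
    (hf : IsTestFunction I f) (K : ℝ≥0) : ∃ B : Ω → ℝ, Integrable B P ∧
      ∀ᵐ ω ∂P, ∀ t ≤ K, |compensator μ σ ν X f t ω| ≤ B ω := by
  refine ⟨_, (hX.integrable_generator f hf K).norm.integral_prod_left, ?_⟩
  filter_upwards [hX.ae_integrableOn hf] with ω hω t ht
  refine (intervalIntegral.norm_integral_le_integral_norm_uIoc
    (f := fun s : ℝ => generator μ σ ν f (X ω s.toNNReal))).trans ?_
  refine setIntegral_mono_set (hω K).norm (.of_forall fun _ => norm_nonneg _) ?_
  refine LE.le.eventuallyLE ?_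
  rw [Set.uIoc_of_le (NNReal.coe_nonneg t)]
  exact Set.Ioc_subset_Icc_self.trans (Set.Icc_subset_Icc_right (by exact_mod_cast ht))

theorem HasGenerator.integrable_comp_sampled (hX : HasGenerator P ℱ I μ σ ν X)
    (hf : IsTestFunction I f) {τ : Ω → ℝ≥0} (hτ : Measurable τ) :
    Integrable (fun ω => f (X ω (τ ω))) P := by
  obtain ⟨C, hC⟩ := hf.exists_abs_le
  exact .of_bound (hX.aemeasurable_comp_sampled hf hτ).aestronglyMeasurable C
    (.of_forall fun ω => hC _)

theorem HasGenerator.aemeasurable_compensator_sampled (hX : HasGenerator P ℱ I μ σ ν X)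
    (hf : IsTestFunction I f) {τ : Ω → ℝ≥0} (hτ : Measurable τ) :
    AEMeasurable (fun ω => compensator μ σ ν X f (τ ω) ω) P :=
  aemeasurable_sampled (hX.measurable_compensator hf)
    ((hX.ae_continuous_compensator hf).mono fun _ hω _ => hω.continuousWithinAt) hτ

/-- Dynkin's formula at bounded optional times. -/
theorem HasGenerator.integral_comp_sampled (hX : HasGenerator P ℱ I μ σ ν X)
    (hf : IsTestFunction I f) {τ : Ω → ℝ≥0} (hτ : IsOptionalTime ℱ τ) {K : ℝ≥0}
    (hK : ∀ ω, τ ω ≤ K) :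
    ∫ ω, f (X ω (τ ω)) ∂P = ∫ ω, (f (X ω (K + 1)) - compensator μ σ ν X f (K + 1) ω) ∂P +
      ∫ ω, compensator μ σ ν X f (τ ω) ω ∂P := by
  obtain ⟨C, hC⟩ := hf.exists_abs_le
  obtain ⟨B, hB, hAB⟩ := hX.exists_compensator_bound hf (K + 1)
  have hA : Integrable (fun ω => compensator μ σ ν X f (τ ω) ω) P := by
    refine hB.mono' (hX.aemeasurable_compensator_sampled hf hτ.measurable).aestronglyMeasurable ?_
    filter_upwards [hAB] with ω hω
    exact hω _ ((hK ω).trans le_self_add)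
  rw [← (hX.martingale_sub hf).integral_sampled hτ hK ?_ (hB.add (integrable_const C)) ?_,
    integral_sub (hX.integrable_comp_sampled hf hτ.measurable) hA, sub_add_cancel]
  · filter_upwards [hX.ae_continuous_compensator hf] with ω hω t
    exact (hf.contDiff.continuous.continuousAt.comp_continuousWithinAt ((X ω).rightCts t)).sub
      hω.continuousWithinAt
  · filter_upwards [hAB] with ω hω t ht
    refine (abs_sub _ _).trans ?_
    rw [add_comm]
    exact add_le_add (hω t ht) (hC _)

/-- In Dynkin's formula the time enters only through the compensator, which is continuous and
dominated even where the path jumps. -/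
theorem HasGenerator.tendsto_integral_comp_sampled (hX : HasGenerator P ℱ I μ σ ν X)
    (hf : IsTestFunction I f) {τ : ℕ → Ω → ℝ≥0} {τ' : Ω → ℝ≥0}
    (hτ : ∀ n, IsOptionalTime ℱ (τ n)) (hτ' : IsOptionalTime ℱ τ') {K : ℝ≥0}
    (hK : ∀ n ω, τ n ω ≤ K) (hlim : ∀ ω, Tendsto (fun n => τ n ω) atTop (𝓝 (τ' ω))) :
    Tendsto (fun n => ∫ ω, f (X ω (τ n ω)) ∂P) atTop (𝓝 (∫ ω, f (X ω (τ' ω)) ∂P)) := by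
  obtain ⟨B, hB, hAB⟩ := hX.exists_compensator_bound hf K
  rw [hX.integral_comp_sampled hf hτ' fun ω => le_of_tendsto' (hlim ω) fun n => hK n ω]
  simp_rw [fun n => hX.integral_comp_sampled hf (hτ n) (hK n)]
  refine tendsto_const_nhds.add (tendsto_integral_of_dominated_convergence B
    (fun n => (hX.aemeasurable_compensator_sampled hf (hτ n).measurable).aestronglyMeasurable)
    hB (fun n => ?_) ?_)
  · filter_upwards [hAB] with ω hω
    exact hω _ (hK n ω)
  · filter_upwards [hX.ae_continuous_compensator hf] with ω hω
    exact (hω.tendsto _).comp (hlim ω)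

/-- A form of quasi-left-continuity: `f(X)` cannot jump away from `0` at a limit of
optional times. -/
theorem HasGenerator.ae_eq_zero_of_eventually (hX : HasGenerator P ℱ I μ σ ν X)
    (hf : IsTestFunction I f) {τ : ℕ → Ω → ℝ≥0} {τ' : Ω → ℝ≥0}
    (hτ : ∀ n, IsOptionalTime ℱ (τ n)) (hτ' : IsOptionalTime ℱ τ') {K : ℝ≥0}
    (hK : ∀ n ω, τ n ω ≤ K) (hlim : ∀ ω, Tendsto (fun n => τ n ω) atTop (𝓝 (τ' ω)))
    (hle : ∀ n ω, f (X ω (τ n ω)) ≤ f (X ω (τ' ω))) :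
    ∀ᵐ ω ∂P, (∀ᶠ n in atTop, f (X ω (τ n ω)) = 0) → f (X ω (τ' ω)) = 0 := by
  -- The differences are nonnegative with integrals tending to `0`, so by Fatou their lower limit
  -- vanishes almost surely; where `f(X)` is eventually `0` along `τ n`, that limit is `f(X)` at
  -- `τ'`.
  have h1 : Tendsto (fun n => ∫ ω, (f (X ω (τ' ω)) - f (X ω (τ n ω))) ∂P) atTop (𝓝 0) := by
    simp_rw [fun n => integral_sub (hX.integrable_comp_sampled hf hτ'.measurable)
      (hX.integrable_comp_sampled hf (hτ n).measurable)]
    simpa using (tendsto_const_nhds (x := ∫ ω, f (X ω (τ' ω)) ∂P)).sub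
      (hX.tendsto_integral_comp_sampled hf hτ hτ' hK hlim)
  have h2 : Tendsto (fun n => ∫⁻ ω, ENNReal.ofReal (f (X ω (τ' ω)) - f (X ω (τ n ω))) ∂P) atTop
      (𝓝 0) := by
    have := ENNReal.tendsto_ofReal h1
    rw [ENNReal.ofReal_zero] at this
    refine this.congr fun n => ofReal_integral_eq_lintegral_ofReal ?_ ?_
    · exact (hX.integrable_comp_sampled hf hτ'.measurable).sub
        (hX.integrable_comp_sampled hf (hτ n).measurable)
    · exact .of_forall fun ω => sub_nonneg.2 (hle n ω)
  have hmeas : ∀ n, AEMeasurable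
      (fun ω => ENNReal.ofReal (f (X ω (τ' ω)) - f (X ω (τ n ω)))) P := fun n =>
    ((hX.aemeasurable_comp_sampled hf hτ'.measurable).sub
      (hX.aemeasurable_comp_sampled hf (hτ n).measurable)).ennreal_ofReal
  have h3 : ∫⁻ ω, liminf (fun n => ENNReal.ofReal (f (X ω (τ' ω)) - f (X ω (τ n ω)))) atTop ∂P
      = 0 := le_antisymm ((lintegral_liminf_le' hmeas).trans_eq h2.liminf_eq) zero_le
  have hliminf : AEMeasurable
      (fun ω => liminf (fun n => ENNReal.ofReal (f (X ω (τ' ω)) - f (X ω (τ n ω)))) atTop) P := by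
    simp_rw [liminf_eq_iSup_iInf_of_nat']
    exact .iSup fun n => .iInf fun i => hmeas (i + n)
  rw [lintegral_eq_zero_iff' hliminf] at h3
  filter_upwards [h3] with ω hω hev
  have h4 : Tendsto (fun n => ENNReal.ofReal (f (X ω (τ' ω)) - f (X ω (τ n ω)))) atTop
      (𝓝 (ENNReal.ofReal (f (X ω (τ' ω))))) :=
    tendsto_const_nhds.congr' (hev.mono fun n hn => by simp only [hn, sub_zero])
  rw [Pi.zero_apply, h4.liminf_eq, ENNReal.ofReal_eq_zero] at hω
  obtain ⟨n, hn⟩ := hev.exists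
  exact le_antisymm hω (hn ▸ hle n ω)

/-- The process has no fixed times of discontinuity. -/
theorem HasGenerator.ae_continuousAt (hX : HasGenerator P ℱ I μ σ ν X) (hI : I.OrdConnected)
    {t : ℝ≥0} (ht : 0 < t) : ∀ᵐ ω ∂P, ContinuousAt (X ω) t := by
  classical
  obtain ⟨F, hF1, hF2, hF3⟩ := exists_testFunctions hI
  obtain ⟨s, -, hst, hs⟩ := exists_seq_strictMono_tendsto' ht
  have key : ∀ p, ∀ᵐ ω ∂P, (∀ᶠ n in atTop, X ω (s n) ∉ tsupport (F p)) → F p (X ω t) = 0 := by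
    intro p
    -- Waiting until `t` when `X` at `s n` lies in the support makes `F p (X)` at `τ n` either `0`
    -- or its value at `t`, hence at most the latter.
    let τ : ℕ → Ω → ℝ≥0 := fun n ω => if X ω (s n) ∈ tsupport (F p) then t else s n
    have hτ : ∀ n, IsOptionalTime ℱ (τ n) := by
      intro n r
      rcases le_or_gt r (s n) with h | h
      · convert MeasurableSet.empty
        ext ω
        simp only [τ, Set.mem_ofPred_eq, Set.mem_empty_iff_false, iff_false, not_lt]
        split_ifs
        · exact h.trans (hst n).2.le
        · exact h
      rcases le_or_gt r t with h' | h'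
      · have : {ω | τ n ω < r} = (fun ω => X ω (s n)) ⁻¹' (tsupport (F p))ᶜ := by
          ext ω
          simp only [τ, Set.mem_ofPred_eq, Set.mem_preimage, Set.mem_compl_iff]
          split_ifs with h1 <;> simp [h1, h, h']
        rw [this]
        exact ℱ.mono h.le _ (hX.adapted (s n) (isClosed_tsupport _).measurableSet.compl)
      · convert MeasurableSet.univ
        ext ω
        simp only [τ, Set.mem_ofPred_eq, Set.mem_univ, iff_true]
        split_ifs
        · exact h'
        · exact h
    have hval : ∀ n ω, F p (X ω (τ n ω)) =
        if X ω (s n) ∈ tsupport (F p) then F p (X ω t) else 0 := by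
      intro n ω
      simp only [τ]
      split_ifs with h
      · rfl
      · exact image_eq_zero_of_notMem_tsupport h
    have hτt : ∀ n ω, τ n ω ≤ t ∧ s n ≤ τ n ω := by
      intro n ω
      simp only [τ]
      split_ifs
      · exact ⟨le_rfl, (hst n).2.le⟩
      · exact ⟨(hst n).2.le, le_rfl⟩
    have := hX.ae_eq_zero_of_eventually (hF1 p) hτ (isOptionalTime_const t)
      (fun n ω => (hτt n ω).1) (fun ω => tendsto_of_tendsto_of_tendsto_of_le_of_le hs
        tendsto_const_nhds (fun n => (hτt n ω).2) fun n => (hτt n ω).1) (fun n ω => by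
        rw [hval]
        split_ifs
        · exact le_rfl
        · exact hF2 _ _)
    filter_upwards [this] with ω hω hev
    exact hω (hev.mono fun n hn => by rw [hval, if_neg hn])
  filter_upwards [ae_all_iff.2 key, hX.mem_interval] with ω hω hI
  obtain ⟨l, hl⟩ := (X ω).leftLim t
  have hlt : l = X ω t := by
    by_contra hne
    obtain ⟨U, V, hU, hV, hlU, hxV, hUV⟩ := t2_separation hne
    obtain ⟨p, hp, hsub⟩ := hF3 _ (hI t) V hV hxV
    have hsl : Tendsto (fun n => X ω (s n)) atTop (𝓝 l) :=
      hl.comp (tendsto_nhdsWithin_iff.2 ⟨hs, .of_forall fun n => (hst n).2⟩)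
    refine hp.ne' (hω p ?_)
    filter_upwards [hsl.eventually (hU.mem_nhds hlU)] with n hn hmem
    exact Set.disjoint_left.1 hUV hn (hsub hmem)
  rw [ContinuousAt, ← nhdsLT_sup_nhdsGE, tendsto_sup]
  exact ⟨hlt ▸ hl, (X ω).rightCts t⟩

end MartingaleProblem

/-! ### Hitting times of levels and the absence of left touching -/

section HittingTimes

open TopologicalSpace (denseSeq denseRange_denseSeq)

namespace CadlagPath

variable {c : ℝ} {u K : ℝ≥0} {ω : CadlagPath}

/-- The first time after `u` at which `ω` exceeds the level `c`, cut off at `K`. -/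
noncomputable def exceedTime (c : ℝ) (u K : ℝ≥0) (ω : CadlagPath) : ℝ≥0 :=
  sInf (insert K {q | u ≤ q ∧ c < ω q})

theorem exceedTime_lt_iff {t : ℝ≥0} :
    exceedTime c u K ω < t ↔ K < t ∨ ∃ q < t, u ≤ q ∧ c < ω q := by
  rw [exceedTime, csInf_lt_iff (OrderBot.bddBelow _) (Set.insert_nonempty _ _)]
  constructor
  · rintro ⟨q, rfl | hq, hqt⟩
    · exact .inl hqt
    · exact .inr ⟨q, hqt, hq⟩
  · rintro (h | ⟨q, hqt, hq⟩)
    · exact ⟨K, .inl rfl, h⟩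
    · exact ⟨q, .inr hq, hqt⟩

theorem exceedTime_le : exceedTime c u K ω ≤ K :=
  csInf_le (OrderBot.bddBelow _) (.inl rfl)

theorem exceedTime_le_of_lt {q : ℝ≥0} (hq : u ≤ q) (h : c < ω q) : exceedTime c u K ω ≤ q :=
  csInf_le (OrderBot.bddBelow _) (.inr ⟨hq, h⟩)

theorem le_exceedTime (h : u ≤ K) : u ≤ exceedTime c u K ω :=
  le_csInf (Set.insert_nonempty _ _) (by rintro q (rfl | hq); exacts [h, hq.1])

theorem exceedTime_mono {c' : ℝ} (h : c ≤ c') : exceedTime c u K ω ≤ exceedTime c' u K ω :=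
  csInf_le_csInf (OrderBot.bddBelow _) (Set.insert_nonempty _ _)
    (Set.insert_subset_insert fun _ hq => ⟨hq.1, h.trans_lt hq.2⟩)

theorem le_apply_exceedTime (h : exceedTime c u K ω < K) : c ≤ ω (exceedTime c u K ω) := by
  by_contra! hlt
  obtain ⟨b, hb, hbc⟩ := exists_forall_Ico_lt hlt
  obtain h1 | ⟨q, h1, h2, h3⟩ := exceedTime_lt_iff.1 (lt_min hb h)
  · exact absurd h1 (not_lt.2 (min_le_right _ _))
  · exact absurd (hbc q (exceedTime_le_of_lt h2 h3) (h1.trans_le (min_le_left _ _)))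
      (not_lt.2 h3.le)

/-- The strict level makes exceedance persist to the right, so a dense time detects it. -/
theorem exists_denseSeq_lt_apply {t : ℝ≥0} (h : ∃ q < t, u ≤ q ∧ c < ω q) :
    ∃ j, denseSeq ℝ≥0 j < t ∧ u ≤ denseSeq ℝ≥0 j ∧ c < ω (denseSeq ℝ≥0 j) := by
  obtain ⟨q, hqt, huq, hq⟩ := h
  obtain ⟨b, hb, hsub⟩ :=
    mem_nhdsGE_iff_exists_Ico_subset.1 ((ω.rightCts q).eventually (lt_mem_nhds hq))
  obtain ⟨_, ⟨j, rfl⟩, h1, h2⟩ := (denseRange_denseSeq ℝ≥0).exists_between (lt_min hb hqt)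
  exact ⟨j, h2.trans_le (min_le_right _ _), huq.trans h1.le,
    hsub ⟨h1.le, h2.trans_le (min_le_left _ _)⟩⟩

theorem isOptionalTime_exceedTime {Ω : Type*} {mΩ : MeasurableSpace Ω}
    {ℱ : Filtration ℝ≥0 mΩ} {X : Ω → CadlagPath} (hX : ∀ t, Measurable[ℱ t] fun ω => X ω t) :
    IsOptionalTime ℱ fun ω => exceedTime c u K (X ω) := by
  intro t
  have h : {ω | exceedTime c u K (X ω) < t} = {_ω | K < t} ∪ ⋃ j, ⋃ _ : denseSeq ℝ≥0 j < t,
      ⋃ _ : u ≤ denseSeq ℝ≥0 j, (fun ω => X ω (denseSeq ℝ≥0 j)) ⁻¹' Set.Ioi c := by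
    ext ω
    simp only [Set.mem_ofPred_eq, Set.mem_union, Set.mem_iUnion, exists_prop, Set.mem_preimage,
      Set.mem_Ioi, exceedTime_lt_iff]
    exact or_congr_right ⟨exists_denseSeq_lt_apply, fun ⟨j, hj⟩ => ⟨_, hj⟩⟩
  rw [h]
  exact (MeasurableSet.const _).union (.iUnion fun j => .iUnion fun hj => .iUnion fun _ =>
    ℱ.mono hj.le _ (hX _ measurableSet_Ioi))

end CadlagPath

open CadlagPath

/-- The process does not approach `L` from the left during an excursion below `L`. -/
theorem HasGenerator.ae_noLeftTouch {Ω : Type*} {mΩ : MeasurableSpace Ω} {P : Measure Ω}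
    [IsProbabilityMeasure P] {ℱ : Filtration ℝ≥0 mΩ} {I : Set ℝ} {μ σ : ℝ → ℝ} {ν : Kernel ℝ ℝ}
    {X : Ω → CadlagPath} (hX : HasGenerator P ℱ I μ σ ν X) (hI : I.OrdConnected) (L : ℝ) :
    ∀ᵐ ω ∂P, NoLeftTouch L (X ω) := by
  obtain ⟨F, hF1, hF2, hF3⟩ := exists_testFunctions hI
  let c : ℕ → ℝ := fun n => L - 1 / ((n : ℝ) + 1)
  have hc : Tendsto c atTop (𝓝 L) := by
    simpa [c] using (tendsto_const_nhds (x := L)).sub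
      (tendsto_one_div_add_atTop_nhds_zero_nat (𝕜 := ℝ))
  have hcm : Monotone c := fun m n hmn => sub_le_sub_left (Nat.one_div_le_one_div hmn) L
  have hbdd : ∀ u K ω m, BddAbove (Set.range fun n => exceedTime (c (m + n)) u K (X ω)) := by
    rintro u K ω m
    exact ⟨K, by rintro _ ⟨n, rfl⟩; exact exceedTime_le⟩
  -- Starting the levels at `c m` keeps `X` at every hitting time before `k` at or above `c m`, off
  -- the support of `F p`; quasi-left-continuity then forces `F p (X) = 0` at the limit time.
  have key : ∀ (m j k : ℕ) (p : ℚ × ℚ), tsupport (F p) ⊆ Set.Iio (c m) →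
      ∀ᵐ ω ∂P, ⨆ n, exceedTime (c (m + n)) (denseSeq ℝ≥0 j) k (X ω) < k →
      F p (X ω (⨆ n, exceedTime (c (m + n)) (denseSeq ℝ≥0 j) k (X ω))) = 0 := by
    intro m j k p hp
    have hzero : ∀ n ω, exceedTime (c (m + n)) (denseSeq ℝ≥0 j) k (X ω) < k →
        F p (X ω (exceedTime (c (m + n)) (denseSeq ℝ≥0 j) k (X ω))) = 0 := by
      intro n ω hlt
      refine image_eq_zero_of_notMem_tsupport fun hmem => ?_
      exact absurd (hp hmem) (not_lt.2 ((hcm le_self_add).trans (le_apply_exceedTime hlt)))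
    have hopt := fun n => isOptionalTime_exceedTime (c := c (m + n)) (u := denseSeq ℝ≥0 j)
      (K := k) hX.adapted
    have := hX.ae_eq_zero_of_eventually (hF1 p) hopt
      (isOptionalTime_iSup hopt fun ω => hbdd _ _ ω _)
      (fun n ω => exceedTime_le) (fun ω => tendsto_atTop_ciSup
        (fun n n' h => exceedTime_mono (hcm (by gcongr))) (hbdd _ _ ω _)) (fun n ω => by
        -- Before the cut-off `k` the value is `0`; if one hitting time equals `k`, so does the
        -- supremum and both sides agree.
        rcases exceedTime_le.lt_or_eq with h | h
        · exact (hzero n ω h).trans_le (hF2 _ _)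
        · have h2 : ⨆ n, exceedTime (c (m + n)) (denseSeq ℝ≥0 j) k (X ω) = k :=
            le_antisymm (ciSup_le fun n => exceedTime_le)
              (h.symm.trans_le (le_ciSup (hbdd _ _ ω _) n))
          rw [h, h2])
    filter_upwards [this] with ω hω hlt
    exact hω (.of_forall fun n => hzero n ω ((le_ciSup (hbdd _ _ ω _) n).trans_lt hlt))
  have key' : ∀ᵐ ω ∂P, ∀ (m j k : ℕ) (p : ℚ × ℚ), tsupport (F p) ⊆ Set.Iio (c m) →
      ⨆ n, exceedTime (c (m + n)) (denseSeq ℝ≥0 j) k (X ω) < k →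
      F p (X ω (⨆ n, exceedTime (c (m + n)) (denseSeq ℝ≥0 j) k (X ω))) = 0 := by
    simp only [ae_all_iff]
    exact key
  filter_upwards [key', hX.mem_interval] with ω hω hI u r hur hlt
  by_contra! hcon
  obtain ⟨_, ⟨j, rfl⟩, huj, hjr⟩ := (denseRange_denseSeq ℝ≥0).exists_between hur
  obtain ⟨k, hk⟩ := exists_nat_gt r
  have hle : ∀ n, exceedTime (c n) (denseSeq ℝ≥0 j) k (X ω) ≤ r := by
    intro n
    have hcL : c n < L := sub_lt_self L (by positivity)
    obtain ⟨c', hc1, hc2⟩ := exists_between hcL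
    obtain ⟨q, hq1, hq2, hq3⟩ := ((hcon c' hc2).and_eventually
      (Ioo_mem_nhdsLT hjr)).exists
    exact (exceedTime_le_of_lt hq2.le (hc1.trans_le hq1)).trans hq3.le
  have hT : ∀ m, denseSeq ℝ≥0 j ≤ ⨆ n, exceedTime (c (m + n)) (denseSeq ℝ≥0 j) k (X ω) ∧
      ⨆ n, exceedTime (c (m + n)) (denseSeq ℝ≥0 j) k (X ω) ≤ r := fun m =>
    ⟨(le_exceedTime (hjr.trans hk).le).trans (le_ciSup (hbdd _ _ ω m) 0),
      ciSup_le fun n => hle _⟩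
  have hTm : ∀ m, ⨆ n, exceedTime (c (m + n)) (denseSeq ℝ≥0 j) k (X ω) =
      ⨆ n, exceedTime (c (0 + n)) (denseSeq ℝ≥0 j) k (X ω) := by
    intro m
    refine le_antisymm (ciSup_le fun n => ?_) (ciSup_le fun n => ?_)
    · rw [← zero_add (m + n)]
      exact le_ciSup (hbdd _ _ ω 0) (m + n)
    · exact (exceedTime_mono (hcm (by omega))).trans (le_ciSup (hbdd _ _ ω m) n)
  set T := ⨆ n, exceedTime (c (0 + n)) (denseSeq ℝ≥0 j) k (X ω) with hTdef
  -- The limit `T` of the hitting times lies in `[u, r]`, where the path is below `L`, hence below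
  -- some `c m`; a test function positive at that value and supported below `c m` contradicts
  -- `key'`.
  have hXT : X ω T < L := hlt T (huj.le.trans (hT 0).1) (hT 0).2
  obtain ⟨m, hm⟩ := (hc.eventually (lt_mem_nhds hXT)).exists
  obtain ⟨p, hp, hsub⟩ := hF3 _ (hI T) _ isOpen_Iio hm
  have := hω m j k p hsub (by rw [hTm]; exact (hT 0).2.trans_lt hk)
  rw [hTm] at this
  exact hp.ne' this

end HittingTimes

/-! ### Conclusion -/

theorem mainTheorem3
    -- the process `X` on an interval `I`, with generator given by `μ`, `σ`, `ν`
    {Ω : Type*} {mΩ : MeasurableSpace Ω} (P : Measure Ω) [IsProbabilityMeasure P]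
    (ℱ : Filtration ℝ≥0 mΩ) (I : Set ℝ) (hI : I.OrdConnected)
    (μ σ : ℝ → ℝ) (ν : Kernel ℝ ℝ) (hν : IsJumpKernel I ν)
    (X : Ω → CadlagPath) (hX : HasGenerator P ℱ I μ σ ν X)
    -- the chains `Y n`
    {Ω' : ℕ → Type*} {mΩ' : ∀ n, MeasurableSpace (Ω' n)} (P' : ∀ n, Measure (Ω' n))
    [∀ n, IsProbabilityMeasure (P' n)]
    (S : ℕ → Finset ℝ) (G : ∀ n, Matrix (S n) (S n) ℝ)
    (Y : ∀ n, Ω' n → CadlagPath) (hY : ∀ n, IsCTMC (P' n) (S n) (G n) (Y n))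
    -- weak convergence of `Y n` to `X` on the Skorokhod space
    (hYX : TendstoInDistribution Y atTop X P' P)
    (L D : ℝ) (hD : 0 < D)
    (hV : ∀ᵐ ω ∂P, X ω ∈ CadlagPath.setV L)
    (hW : ∀ᵐ ω ∂P, X ω ∈ CadlagPath.setW L D)
    (hUp : ∀ᵐ ω ∂P, X ω ∈ CadlagPath.setUPlus L)
    (hUm : ∀ᵐ ω ∂P, X ω ∈ CadlagPath.setUMinus L)
    (f : ℝ → ℝ) (hf : ∃ C, ∀ x, |f x| ≤ C)
    (t : ℝ≥0) (ht : 0 < t)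
    (hft : P {ω | ¬ ContinuousAt f (X ω t)} = 0)
    (hτt : P {ω | CadlagPath.parisianTime L D (X ω) = t} = 0) :
    (∀ n, Integrable ({ω | CadlagPath.parisianTime L D (Y n ω) ≤ t}.indicator
      (fun ω => f (Y n ω t))) (P' n)) ∧
    Integrable ({ω | CadlagPath.parisianTime L D (X ω) ≤ t}.indicator (fun ω => f (X ω t))) P ∧
    Tendsto (fun n => ∫ ω, {ω | CadlagPath.parisianTime L D (Y n ω) ≤ t}.indicator
        (fun ω => f (Y n ω t)) ω ∂(P' n)) atTop
      (𝓝 (∫ ω, {ω | CadlagPath.parisianTime L D (X ω) ≤ t}.indicator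
        (fun ω => f (X ω t)) ω ∂P)) := by
  obtain ⟨C, hC⟩ := hf
  lift D to ℝ≥0 using hD.le
  have hD' : 0 < D := hD
  let F : CadlagPath → ℝ := {ω | CadlagPath.parisianTime L D ω ≤ t}.indicator fun ω => f (ω t)
  have hF : ∀ x, |F x| ≤ C := fun x =>
    (norm_indicator_le_norm_self (fun ω : CadlagPath => f (ω t)) x).trans (hC _)
  have hFY : ∀ n, AEMeasurable (fun ω => F (Y n ω)) (P' n) := fun n =>
    CadlagPath.aemeasurable_indicator_parisianTime (hY n).measurable_eval (hY n).mem_states hD' f t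
  have hFX : ∀ᵐ ω ∂P, ContinuousAt F (X ω) := by
    have hft' : ∀ᵐ ω ∂P, ContinuousAt f (X ω t) := hft
    have hτt' : ∀ᵐ ω ∂P, CadlagPath.parisianTime L D (X ω) ≠ t := by
      rw [ae_iff]
      simpa using hτt
    filter_upwards [hV, hW, hUp, hft', hτt', hX.ae_continuousAt hI ht, hX.ae_noLeftTouch hI L]
      with ω h1 h2 h3 h4 h5 h6 h7
    exact CadlagPath.continuousAt_indicator_parisianTime hD' h1 h2 h3 h7 h5 h6 h4
  refine ⟨fun n => ?_, ?_, tendsto_integral_of_ae_continuousAt hYX hF hFY hFX⟩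
  · exact .of_bound (hFY n).aestronglyMeasurable C (.of_forall fun ω => hF _)
  · exact .of_bound (aemeasurable_comp_of_ae_continuousAt hYX.aemeasurable_limit
      hFX).aestronglyMeasurable C (.of_forall fun ω => hF _)
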